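/- Let $I$ be a finite set and let $\mathcal V=(V,\eta,\xi)$ be a polarized arrangement indexed by $I$: $V\subseteq\mathbb R^I$ is a linear subspace, $\eta\in\mathbb R^I/V$, $\xi\in V^*=(\mathbb R^I)^*/V^\perp$, such that every lift of $\eta$ to $\mathbb R^I$ has at least $|I|-\dim V$ non-zero entries and every lift of $\xi$ to $(\mathbb R^I)^*$ has at least $\dim V$ non-zero entries. Its Gale dual is the polarized arrangement $\mathcal V^\vee=(V^\perp,-\xi,-\eta)$, where $(\mathbb R^I)^*$ is identified with $\mathbb R^I$ by the standard basis. Put $V_\eta=\{x\in\mathbb R^I: x+V=\eta\}$ and $H_S=\{x\in V_\eta: x_i=0\ \forall i\in S\}$ for $S\subseteq I$. For $\alpha\in\{\pm1\}^I$ put $\Delta_\alpha=\{x\in V_\eta:\alpha(i)x_i\ge 0\ \forall i\}$ and $\Sigma_\alpha=\{x\in V:\alpha(i)x_i\ge0\ \forall i\}$. Let $\mathcal F=\{\alpha:\Delta_\alpha\ne\emptyset\}$ and $\mathcal P=\{\alpha\in\mathcal F:\xi(\Sigma_\alpha)\text{ is bounded above}\}$; write $\mathcal F^\vee,\mathcal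 P^\vee$ for the corresponding sets for $\mathcal V^\vee$. Write $\alpha\leftrightarrow\beta$ if $\alpha,\beta$ differ in exactly one entry. *The algebra $A$.* Let $P(Q)$ be the real path algebra (paths composed from left to right) of the quiver with vertex set $\mathcal F$ and one arrow $p(\alpha,\beta)$ from $\alpha$ to $\beta$ whenever $\alpha\leftrightarrow\beta$, with vertex idempotents $e_\alpha$. Let $t_i\in V^*$ be the restriction of the $i$-th coordinate function. Then $A(\mathcal V)$ is the quotient of $P(Q)\otimes_{\mathbb R}\operatorname{Sym}V^*$ by the two-sided ideal generated by the relations: $e_\alpha=0$ for $\alpha\in\mathcal F\smallsetminus\mathcal P$; $p(\alpha,\beta)p(\beta,\gamma)=p(\alpha,\delta)p(\delta,\gamma)$ for distinct $\alpha,\beta,\gamma,\delta\in\mathcal F$ with $\alpha\leftrightarrow\beta\leftrightarrow\gamma\leftrightarrow\delta\leftrightarrow\alpha$; $p(\alpha,\beta)p(\beta,\alpha)=t_ie_\alpha$ for $\alpha,\beta\in\mathcal F$ that differ exactly in the $i$-th entry. It is graded by $\deg e_\alpha=0$, $\deg p(\alpha,\beta)=1$, $\deg t_i=2$. *The algebra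 $B$.* For $\Delta\subseteq V_\eta$ let $R_\Delta=\big(\mathbb R[u_i]_{i\in I}/\langle u_S: H_S\cap\Delta=\emptyset\rangle\big)\otimes_{\operatorname{Sym}V}\mathbb R$, where $u_S=\prod_{i\in S}u_i$, $\deg u_i=2$, $\operatorname{Sym}V\to\operatorname{Sym}\mathbb R^I=\mathbb R[u_i]$ is induced by $V\subseteq\mathbb R^I$, and $\operatorname{Sym}V\to\mathbb R$ kills $V$. Write $R_{\alpha\beta}=R_{\Delta_\alpha\cap\Delta_\beta}$ and $R_{\alpha\beta\gamma}=R_{\Delta_\alpha\cap\Delta_\beta\cap\Delta_\gamma}$. With $d_{\alpha\beta}=|\{i:\alpha(i)\ne\beta(i)\}|$, put $B(\mathcal V)=\bigoplus_{(\alpha,\beta)\in\mathcal P\times\mathcal P}R_{\alpha\beta}[-d_{\alpha\beta}]$, where $R[-d]$ has degree $n$ part $R_{n-d}$. The product of $x\in R_{\alpha\beta}$ and $y\in R_{\beta\gamma}$ is obtained by multiplying their images in $R_{\alpha\beta\gamma}$ and applying the map $R_{\alpha\beta\gamma}\to R_{\alpha\gamma}$ induced by multiplication by $u_{S(\alpha\beta\gamma)}$,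 where $S(\alpha\beta\gamma)=\{i:\alpha(i)=\gamma(i)\neq\beta(i)\}$; the product of $R_{\alpha\beta}$ and $R_{\delta\gamma}$ is zero if $\beta\ne\delta$. Let $1_{\alpha\beta}$ be the unit of $R_{\alpha\beta}$, and let $\zeta(f)\in\bigoplus_{\alpha}R_{\alpha\alpha}\subseteq B(\mathcal V)$ be the element whose components are the images of $f\in\mathbb R[u_i]_{i\in I}$. **Theorem.** One has $\mathcal P^\vee=\mathcal P$, the algebras $A(\mathcal V^\vee)$ and $B(\mathcal V)$ are graded $\mathbb R$-algebras, and there is a natural isomorphism of graded rings $\phi:A(\mathcal V^\vee)\cong B(\mathcal V)$; namely, there is a unique isomorphism $\phi$ of graded $\mathbb R$-algebras such that $\phi(e_\alpha)=1_{\alpha\alpha}$ for all $\alpha\in\mathcal P$, $\phi(p(\alpha,\beta))=1_{\alpha\beta}$ for all $\alpha,\beta\in\mathcal P$ with $\alpha\leftrightarrow\beta$, and $\phi(t_i)=\zeta(u_i)$ for all $i\in I$. -/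

import Mathlib

open scoped TensorProduct

noncomputable section

section LinearAlgebra

variable {I : Type*} [Fintype I]

/-- The restriction map `(ℝ^I)^* → V^*`, where `(ℝ^I)^*` is identified with `ℝ^I` through the
standard basis: `w` is sent to `v ↦ ∑ i, w i * v i`. -/
def dotRestrict (V : Submodule ℝ (I → ℝ)) : (I → ℝ) →ₗ[ℝ] Module.Dual ℝ V :=
  V.dualRestrict ∘ₗ dotProductBilin ℝ ℝ

theorem dotRestrict_apply (V : Submodule ℝ (I → ℝ)) (w : I → ℝ) (v : V) :
    dotRestrict V w v = ∑ i, w i * (v : I → ℝ) i := rfl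

theorem dotRestrict_surjective (V : Submodule ℝ (I → ℝ)) :
    Function.Surjective (dotRestrict V) := by
  classical
  have h1 : Function.Surjective V.dualRestrict := Subspace.dualRestrict_surjective
  exact h1.comp (dotProductEquiv ℝ I).surjective

/-- `V^⊥ ⊆ (ℝ^I)^* = ℝ^I`, the space of linear forms that vanish on `V`. -/
def perp (V : Submodule ℝ (I → ℝ)) : Submodule ℝ (I → ℝ) := LinearMap.ker (dotRestrict V)

theorem mem_perp {V : Submodule ℝ (I → ℝ)} {w : I → ℝ} :
    w ∈ perp V ↔ ∀ v ∈ V, ∑ i, w i * v i = 0 := by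
  simp [perp, LinearMap.ext_iff, dotRestrict_apply]

theorem finrank_perp (V : Submodule ℝ (I → ℝ)) :
    Module.finrank ℝ V + Module.finrank ℝ (perp V) = Fintype.card I := by
  have h := LinearMap.finrank_range_add_finrank_ker (dotRestrict V)
  rw [LinearMap.range_eq_top.2 (dotRestrict_surjective V), finrank_top,
    Subspace.dual_finrank_eq, Module.finrank_fintype_fun_eq_card] at h
  exact h

theorem le_perp_perp (V : Submodule ℝ (I → ℝ)) : V ≤ perp (perp V) := by
  intro v hv
  rw [mem_perp]
  intro w hw
  rw [← mem_perp.1 hw v hv]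
  exact Finset.sum_congr rfl fun i _ => mul_comm _ _

theorem perp_perp (V : Submodule ℝ (I → ℝ)) : perp (perp V) = V := by
  symm
  refine Submodule.eq_of_le_of_finrank_eq (le_perp_perp V) ?_
  have h1 := finrank_perp V
  have h2 := finrank_perp (perp V)
  omega

/-- The isomorphism `(ℝ^I)^* / V^⊥ ≃ V^*`. -/
def quotPerpEquiv (V : Submodule ℝ (I → ℝ)) : ((I → ℝ) ⧸ perp V) ≃ₗ[ℝ] Module.Dual ℝ V :=
  (dotRestrict V).quotKerEquivOfSurjective (dotRestrict_surjective V)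

/-- The isomorphism `ℝ^I / V → (V^⊥)^*` (as a linear map), sending the class of `x` to
`w ↦ ∑ i, x i * w i`. -/
def quotToDualPerp (V : Submodule ℝ (I → ℝ)) : ((I → ℝ) ⧸ V) →ₗ[ℝ] Module.Dual ℝ (perp V) :=
  V.liftQ (dotRestrict (perp V)) (le_perp_perp V)

end LinearAlgebra

/-- A polarized arrangement indexed by `I`: a subspace `V ⊆ ℝ^I`, a vector `η ∈ ℝ^I / V` and a
covector `ξ ∈ V^*` such that every lift of `η` to `ℝ^I` has at least `|I| - dim V` non-zero
entries and every lift of `ξ` to `(ℝ^I)^*` has at least `dim V` non-zero entries. -/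
structure PolarizedArrangement (I : Type*) [Fintype I] where
  V : Submodule ℝ (I → ℝ)
  η : (I → ℝ) ⧸ V
  ξ : Module.Dual ℝ V
  η_generic : ∀ x : I → ℝ, V.mkQ x = η →
    Fintype.card I ≤ Module.finrank ℝ V + {i : I | x i ≠ 0}.ncard
  ξ_generic : ∀ w : I → ℝ, dotRestrict V w = ξ →
    Module.finrank ℝ V ≤ {i : I | w i ≠ 0}.ncard

/-- A sign vector `α ∈ {±1}^I`. -/
abbrev SignVector (I : Type*) := I → ℤˣ

namespace SignVector

variable {I : Type*}

/-- `α` and `β` differ in the `i`-th entry and nowhere else. -/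
def AdjAt (i : I) (α β : SignVector I) : Prop := ∀ j, α j ≠ β j ↔ j = i

/-- `α` and `β` differ in exactly one entry. -/
def Adj (α β : SignVector I) : Prop := ∃ i, AdjAt i α β

variable [Fintype I]

/-- The number of entries in which `α` and `β` differ. -/
def dist (α β : SignVector I) : ℕ := (Finset.univ.filter fun i => α i ≠ β i).card

/-- The set of `i` with `α i = γ i ≠ β i`. -/
def S (α β γ : SignVector I) : Finset I := Finset.univ.filter fun i => α i = γ i ∧ γ i ≠ β i

theorem S_assoc [DecidableEq I] (α β γ δ : SignVector I) (i : I) :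
    ((if i ∈ S α β γ then 1 else 0) + if i ∈ S α γ δ then 1 else 0 : ℕ)
      = (if i ∈ S β γ δ then 1 else 0) + if i ∈ S α β δ then 1 else 0 := by
  simp only [S, Finset.mem_filter, Finset.mem_univ, true_and]
  rcases Int.units_eq_one_or (α i) with h1 | h1 <;> rcases Int.units_eq_one_or (β i) with h2 | h2 <;>
  rcases Int.units_eq_one_or (γ i) with h3 | h3 <;> rcases Int.units_eq_one_or (δ i) with h4 | h4 <;>
  simp [h1, h2, h3, h4]

end SignVector

/-! ### The path algebra of a finite quiver -/

/-- Real linear combinations of paths in the (finite) quiver `Q`, sorted by their end points. The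
product is concatenation from left to right, and it is zero on paths that do not match. -/
def PathAlgebra (Q : Type*) [Quiver Q] : Type _ := (a b : Q) → (Quiver.Path a b →₀ ℝ)

namespace PathAlgebra

variable {Q : Type*} [Quiver Q]

instance : AddCommGroup (PathAlgebra Q) :=
  inferInstanceAs (AddCommGroup ((a b : Q) → (Quiver.Path a b →₀ ℝ)))

instance : Module ℝ (PathAlgebra Q) :=
  inferInstanceAs (Module ℝ ((a b : Q) → (Quiver.Path a b →₀ ℝ)))

/-- The bilinear extension of the concatenation of paths. -/
def concat (a b c : Q) : (Quiver.Path a b →₀ ℝ) →ₗ[ℝ] (Quiver.Path b c →₀ ℝ) →ₗ[ℝ]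
    (Quiver.Path a c →₀ ℝ) :=
  Finsupp.lsum ℝ fun p => LinearMap.toSpanSingleton ℝ _ (Finsupp.lmapDomain ℝ ℝ fun q => p.comp q)

@[simp] theorem concat_single {a b c : Q} (p : Quiver.Path a b) (q : Quiver.Path b c) (r s : ℝ) :
    concat a b c (Finsupp.single p r) (Finsupp.single q s) = Finsupp.single (p.comp q) (r * s) := by
  simp [concat]

theorem concat_assoc {a b c d : Q} (x : Quiver.Path a b →₀ ℝ) (y : Quiver.Path b c →₀ ℝ)
    (z : Quiver.Path c d →₀ ℝ) :
    concat a c d (concat a b c x y) z = concat a b d x (concat b c d y z) := by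
  induction x using Finsupp.induction_linear with
  | zero => simp
  | add x x' hx hx' => simp [hx, hx']
  | single p r =>
    induction y using Finsupp.induction_linear with
    | zero => simp
    | add y y' hy hy' => simp [hy, hy']
    | single q s =>
      induction z using Finsupp.induction_linear with
      | zero => simp
      | add z z' hz hz' => simp only [map_add, hz, hz']
      | single t u => simp only [concat_single, Quiver.Path.comp_assoc, mul_assoc]

theorem concat_nil_left {a b : Q} (x : Quiver.Path a b →₀ ℝ) :
    concat a a b (Finsupp.single Quiver.Path.nil 1) x = x := by
  induction x using Finsupp.induction_linear with
  | zero => simp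
  | add x y hx hy => simp [hx, hy]
  | single p r => simp

theorem concat_nil_right {a b : Q} (x : Quiver.Path a b →₀ ℝ) :
    concat a b b x (Finsupp.single Quiver.Path.nil 1) = x := by
  induction x using Finsupp.induction_linear with
  | zero => simp
  | add x y hx hy => simp [hx, hy]
  | single p r => simp

open Classical in
/-- The element of the path algebra that is given by a single path. -/
def ofPath {a b : Q} (p : Quiver.Path a b) : PathAlgebra Q :=
  Pi.single a (Pi.single b (Finsupp.single p 1))

/-- The idempotent `e_a`, i.e. the path of length zero at `a`. -/
def e (a : Q) : PathAlgebra Q := ofPath (Quiver.Path.nil : Quiver.Path a a)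

/-- The edge path of an arrow. -/
def edge {a b : Q} (f : a ⟶ b) : PathAlgebra Q := ofPath f.toPath

/-- The linear combinations of paths of length `l`. -/
def gradedPiece (Q : Type*) [Quiver Q] (l : ℕ) : Submodule ℝ (PathAlgebra Q) where
  carrier := {x | ∀ (a b : Q) (p : Quiver.Path a b), x a b p ≠ 0 → p.length = l}
  zero_mem' := fun a b p h => absurd rfl h
  add_mem' := fun {x y} hx hy a b p h => by
    by_contra hp
    have h1 : x a b p = 0 := by by_contra h'; exact hp (hx a b p h')
    have h2 : y a b p = 0 := by by_contra h'; exact hp (hy a b p h')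
    exact h (show x a b p + y a b p = 0 by rw [h1, h2, add_zero])
  smul_mem' := fun r x hx a b p h =>
    hx a b p fun h' => h (show r * x a b p = 0 by rw [h', mul_zero])

theorem add_apply (x y : PathAlgebra Q) (a b : Q) : (x + y) a b = x a b + y a b := rfl

variable [Fintype Q]

instance : Mul (PathAlgebra Q) := ⟨fun x y a c => ∑ b, concat a b c (x a b) (y b c)⟩

instance : One (PathAlgebra Q) := ⟨∑ a, e a⟩

theorem mul_apply (x y : PathAlgebra Q) (a c : Q) :
    (x * y) a c = ∑ b, concat a b c (x a b) (y b c) := rfl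

theorem one_apply (a b : Q) : (1 : PathAlgebra Q) a b = ∑ c, e c a b := by
  change (LinearMap.proj b ∘ₗ LinearMap.proj a :
    ((a b : Q) → (Quiver.Path a b →₀ ℝ)) →ₗ[ℝ] _) (∑ c, e c : PathAlgebra Q) = _
  exact map_sum (LinearMap.proj b ∘ₗ LinearMap.proj a :
    ((a b : Q) → (Quiver.Path a b →₀ ℝ)) →ₗ[ℝ] _) (fun c => (e c : PathAlgebra Q)) Finset.univ

theorem one_apply_self (a : Q) :
    (1 : PathAlgebra Q) a a = Finsupp.single Quiver.Path.nil 1 := by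
  classical
  rw [one_apply, Finset.sum_eq_single a]
  · simp [e, ofPath]
  · intro c _ hc
    simp [e, ofPath, Pi.single_eq_of_ne hc.symm]
  · simp

theorem one_apply_ne {a b : Q} (h : a ≠ b) : (1 : PathAlgebra Q) a b = 0 := by
  classical
  rw [one_apply]
  refine Finset.sum_eq_zero fun c _ => ?_
  by_cases hc : a = c
  · subst hc
    simp [e, ofPath, Pi.single_eq_of_ne h.symm]
  · simp [e, ofPath, Pi.single_eq_of_ne hc]

instance : Ring (PathAlgebra Q) :=
  { (inferInstance : AddCommGroup (PathAlgebra Q)),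
    (inferInstance : Mul (PathAlgebra Q)), (inferInstance : One (PathAlgebra Q)) with
    left_distrib := fun x y z => by
      funext a c
      simp only [mul_apply, add_apply, map_add, Finset.sum_add_distrib]
    right_distrib := fun x y z => by
      funext a c
      simp only [mul_apply, add_apply, map_add, LinearMap.add_apply, Finset.sum_add_distrib]
    zero_mul := fun x => by
      funext a c
      refine Finset.sum_eq_zero fun b _ => ?_
      change concat a b c 0 _ = 0
      simp
    mul_zero := fun x => by
      funext a c
      refine Finset.sum_eq_zero fun b _ => ?_
      change concat a b c _ 0 = 0
      simp
    mul_assoc := fun x y z => by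
      funext a d
      simp only [mul_apply, map_sum, LinearMap.sum_apply, concat_assoc]
      exact Finset.sum_comm
    one_mul := fun x => by
      funext a c
      rw [mul_apply, Finset.sum_eq_single a]
      · rw [one_apply_self, concat_nil_left]
      · intro b _ hb
        rw [one_apply_ne hb.symm]; simp
      · simp
    mul_one := fun x => by
      funext a c
      rw [mul_apply, Finset.sum_eq_single c]
      · rw [one_apply_self, concat_nil_right]
      · intro b _ hb
        rw [one_apply_ne hb]; simp
      · simp }

instance : Algebra ℝ (PathAlgebra Q) :=
  Algebra.ofModule
    (fun r x y => by
      funext a c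
      change ∑ b, concat a b c (r • x a b) (y b c) = r • ∑ b, concat a b c (x a b) (y b c)
      simp [Finset.smul_sum])
    (fun r x y => by
      funext a c
      change ∑ b, concat a b c (x a b) (r • y b c) = r • ∑ b, concat a b c (x a b) (y b c)
      simp [Finset.smul_sum])

end PathAlgebra

namespace PolarizedArrangement

variable {I : Type*} [Fintype I] (𝒱 : PolarizedArrangement I)

/-! ### Chambers -/

/-- The affine space `V_η`, the set of all lifts of `η`. -/
def space : Set (I → ℝ) := {x | 𝒱.V.mkQ x = 𝒱.η}

/-- The flat `H_S ⊆ V_η`, the intersection of the hyperplanes `x i = 0` for `i ∈ S`. -/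
def flat (S : Finset I) : Set (I → ℝ) := {x ∈ 𝒱.space | ∀ i ∈ S, x i = 0}

/-- The polyhedron `Δ_α ⊆ V_η`. -/
def Δ (α : SignVector I) : Set (I → ℝ) := {x ∈ 𝒱.space | ∀ i, 0 ≤ ((α i : ℤ) : ℝ) * x i}

/-- The cone `Σ_α ⊆ V`. -/
def cone (α : SignVector I) : Set 𝒱.V := {v | ∀ i, 0 ≤ ((α i : ℤ) : ℝ) * (v : I → ℝ) i}

/-- The feasible sign vectors. -/
def feasible : Set (SignVector I) := {α | (𝒱.Δ α).Nonempty}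

/-- The bounded sign vectors. -/
def bounded : Set (SignVector I) := {α | BddAbove (𝒱.ξ '' 𝒱.cone α)}

/-- The bounded feasible sign vectors. -/
def P : Set (SignVector I) := 𝒱.feasible ∩ 𝒱.bounded

instance : Fintype 𝒱.P := Fintype.ofFinite _

/-- The Gale dual `(V^⊥, -ξ, -η)`, with `ξ ∈ V^* = (ℝ^I)^* / V^⊥` and with `η ∈ ℝ^I / V` acting
on `V^⊥`. -/
def galeDual : PolarizedArrangement I where
  V := perp 𝒱.V
  η := -(quotPerpEquiv 𝒱.V).symm 𝒱.ξ
  ξ := -quotToDualPerp 𝒱.V 𝒱.η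
  η_generic := fun x hx => by
    have h1 : dotRestrict 𝒱.V (-x) = 𝒱.ξ := by
      have h2 : (quotPerpEquiv 𝒱.V) ((perp 𝒱.V).mkQ (-x)) = 𝒱.ξ := by
        rw [map_neg, hx, neg_neg, LinearEquiv.apply_symm_apply]
      exact h2
    have h3 := 𝒱.ξ_generic (-x) h1
    simp only [Pi.neg_apply, ne_eq, neg_eq_zero] at h3
    have h4 := finrank_perp 𝒱.V
    simp only [ne_eq]
    omega
  ξ_generic := fun w hw => by
    have h1 : 𝒱.V.mkQ (-w) = 𝒱.η := by
      obtain ⟨y, hy⟩ := 𝒱.V.mkQ_surjective 𝒱.η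
      rw [← hy] at hw ⊢
      have h2 : dotRestrict (perp 𝒱.V) (w + y) = 0 := by
        rw [map_add, hw]
        change -(dotRestrict (perp 𝒱.V) y) + dotRestrict (perp 𝒱.V) y = 0
        simp
      have h3 : w + y ∈ 𝒱.V := by
        have : w + y ∈ perp (perp 𝒱.V) := h2
        rwa [perp_perp] at this
      rw [Submodule.mkQ_apply, Submodule.mkQ_apply, Submodule.Quotient.eq]
      have h4 := 𝒱.V.neg_mem h3
      rwa [neg_add, ← sub_eq_add_neg] at h4
    have h3 := 𝒱.η_generic (-w) h1
    simp only [Pi.neg_apply, ne_eq, neg_eq_zero] at h3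
    have h4 := finrank_perp 𝒱.V
    simp only [ne_eq]
    omega

/-! ### The algebra `A` -/

/-- The vertices of the quiver `Q`: the feasible sign vectors. -/
def Vertex : Type _ := {α : SignVector I // α ∈ 𝒱.feasible}

/-- There is exactly one arrow from `α` to `β` if they differ in exactly one entry, and no arrow
otherwise. -/
instance : Quiver 𝒱.Vertex := ⟨fun a b => PLift (SignVector.Adj a.1 b.1)⟩

instance : Fintype 𝒱.Vertex :=
  haveI : Finite 𝒱.Vertex := inferInstanceAs (Finite {α : SignVector I // α ∈ 𝒱.feasible})
  Fintype.ofFinite _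

/-- The edge path `p(α, β)`. -/
def edgePath {a b : 𝒱.Vertex} (h : SignVector.Adj a.1 b.1) : PathAlgebra 𝒱.Vertex :=
  PathAlgebra.edge (PLift.up h : a ⟶ b)

/-- The restriction `t_i ∈ V^*` of the `i`-th coordinate function. -/
def coord (i : I) : Module.Dual ℝ 𝒱.V := LinearMap.proj i ∘ₗ 𝒱.V.subtype

/-- `P(Q) ⊗ Sym V^*`. -/
abbrev PreA : Type _ := PathAlgebra 𝒱.Vertex ⊗[ℝ] SymmetricAlgebra ℝ (Module.Dual ℝ 𝒱.V)

/-- The relations of the algebra `A`: `e_α = 0` if `α` is feasible but not bounded;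
`p(α, β, γ) = p(α, δ, γ)` for distinct feasible `α`, `β`, `γ`, `δ`, cyclically adjacent; and
`p(α, β, α) = t_i e_α` if the feasible `α` and `β` differ exactly in the `i`-th entry. -/
inductive RelA : 𝒱.PreA → 𝒱.PreA → Prop
  | A1 (a : 𝒱.Vertex) (ha : a.1 ∉ 𝒱.P) : RelA (PathAlgebra.e a ⊗ₜ 1) 0
  | A2 (a b c d : 𝒱.Vertex) (hne : [a, b, c, d].Nodup)
      (hab : SignVector.Adj a.1 b.1) (hbc : SignVector.Adj b.1 c.1)
      (hcd : SignVector.Adj c.1 d.1) (hda : SignVector.Adj d.1 a.1)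
      (had : SignVector.Adj a.1 d.1) (hdc : SignVector.Adj d.1 c.1) :
      RelA ((𝒱.edgePath hab * 𝒱.edgePath hbc) ⊗ₜ 1) ((𝒱.edgePath had * 𝒱.edgePath hdc) ⊗ₜ 1)
  | A3 (a b : 𝒱.Vertex) (i : I) (hi : SignVector.AdjAt i a.1 b.1)
      (hab : SignVector.Adj a.1 b.1) (hba : SignVector.Adj b.1 a.1) :
      RelA ((𝒱.edgePath hab * 𝒱.edgePath hba) ⊗ₜ 1)
        (PathAlgebra.e a ⊗ₜ SymmetricAlgebra.ι ℝ _ (𝒱.coord i))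

/-- The algebra `A(𝒱)`, the quotient of `P(Q) ⊗ Sym V^*` by the two-sided ideal generated by the
relations. -/
abbrev A : Type _ := RingQuot 𝒱.RelA

namespace A

/-- The quotient map `P(Q) ⊗ Sym V^* → A`. -/
def mk : 𝒱.PreA →ₐ[ℝ] 𝒱.A := RingQuot.mkAlgHom ℝ 𝒱.RelA

/-- The class of `e_α` in `A`. -/
def e (a : 𝒱.Vertex) : 𝒱.A := mk 𝒱 (PathAlgebra.e a ⊗ₜ 1)

/-- The class of `p(α, β)` in `A`. -/
def p {a b : 𝒱.Vertex} (h : SignVector.Adj a.1 b.1) : 𝒱.A := mk 𝒱 (𝒱.edgePath h ⊗ₜ 1)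

/-- The class of `t_i` in `A`. -/
def t (i : I) : 𝒱.A := mk 𝒱 (1 ⊗ₜ SymmetricAlgebra.ι ℝ _ (𝒱.coord i))

/-- The degree `n` part of `A`: it is spanned by the classes of `x ⊗ s`, where `x` is a combination
of paths of length `l`, where `s ∈ Sym^m V^*`, and where `l + 2 m = n`. -/
def gradedPiece (n : ℕ) : Submodule ℝ 𝒱.A :=
  Submodule.span ℝ {z | ∃ l m : ℕ, l + 2 * m = n ∧ ∃ x ∈ PathAlgebra.gradedPiece 𝒱.Vertex l,
    ∃ s ∈ (LinearMap.range (SymmetricAlgebra.ι ℝ (Module.Dual ℝ 𝒱.V))) ^ m, z = mk 𝒱 (x ⊗ₜ s)}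

end A

/-! ### The algebra `B` -/

/-- The monomial `u_S`. -/
def u (S : Finset I) : MvPolynomial I ℝ := ∏ i ∈ S, MvPolynomial.X i

/-- The ideal of `Sym ℝ^I = ℝ[u_i]` generated by the monomials `u_S` with `H_S ∩ D = ∅`. -/
def faceIdeal (D : Set (I → ℝ)) : Ideal (MvPolynomial I ℝ) :=
  Ideal.span {f | ∃ S : Finset I, 𝒱.flat S ∩ D = ∅ ∧ f = u S}

/-- The ideal of `Sym ℝ^I` generated by `V ⊆ ℝ^I`. -/
def linearIdeal : Ideal (MvPolynomial I ℝ) :=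
  Ideal.span {f | ∃ v ∈ 𝒱.V, f = ∑ i, MvPolynomial.C (v i) * MvPolynomial.X i}

/-- The ideal that defines the ring `R_D`. -/
def idealR (D : Set (I → ℝ)) : Ideal (MvPolynomial I ℝ) := 𝒱.faceIdeal D ⊔ 𝒱.linearIdeal

/-- The ring `R_D`, the quotient of `Sym ℝ^I` by the `u_S` with `H_S ∩ D = ∅`, tensored over
`Sym V` with `ℝ = Sym V / (V)`, i.e. taken modulo the ideal generated by the image of `V`. -/
def R (D : Set (I → ℝ)) : Type _ := MvPolynomial I ℝ ⧸ 𝒱.idealR D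

instance (D : Set (I → ℝ)) : CommRing (𝒱.R D) :=
  inferInstanceAs (CommRing (MvPolynomial I ℝ ⧸ 𝒱.idealR D))

instance (D : Set (I → ℝ)) : Algebra ℝ (𝒱.R D) :=
  inferInstanceAs (Algebra ℝ (MvPolynomial I ℝ ⧸ 𝒱.idealR D))

/-- The quotient map `Sym ℝ^I → R_D`. -/
def mkR (D : Set (I → ℝ)) : MvPolynomial I ℝ →ₐ[ℝ] 𝒱.R D := Ideal.Quotient.mkₐ ℝ (𝒱.idealR D)

theorem mkR_surjective (D : Set (I → ℝ)) : Function.Surjective (𝒱.mkR D) :=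
  Ideal.Quotient.mkₐ_surjective ℝ (𝒱.idealR D)

theorem mkR_eq_zero (D : Set (I → ℝ)) (f : MvPolynomial I ℝ) :
    𝒱.mkR D f = 0 ↔ f ∈ 𝒱.idealR D :=
  Ideal.Quotient.eq_zero_iff_mem

theorem idealR_mono {D D' : Set (I → ℝ)} (h : D ⊆ D') : 𝒱.idealR D' ≤ 𝒱.idealR D := by
  refine sup_le_sup_right (Ideal.span_mono ?_) _
  rintro _ ⟨S, hS, rfl⟩
  exact ⟨S, Set.subset_eq_empty (Set.inter_subset_inter_right _ h) hS, rfl⟩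

/-- The natural quotient map `R_{D'} → R_D` for `D ⊆ D'`. -/
def quotientMap {D D' : Set (I → ℝ)} (h : D ⊆ D') : 𝒱.R D' →ₐ[ℝ] 𝒱.R D :=
  Ideal.Quotient.factorₐ ℝ (𝒱.idealR_mono h)

/-- The degree `n` part of the graded ring `R_D`, where each `u_i` has degree `2`. -/
def gradedPieceR (D : Set (I → ℝ)) (n : ℕ) : Submodule ℝ (𝒱.R D) :=
  (MvPolynomial.weightedHomogeneousSubmodule ℝ (fun _ : I => 2) n).map
    (𝒱.mkR D).toLinearMap

/-- `Δ_α ∩ Δ_β`. -/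
abbrev Δ₂ (α β : SignVector I) : Set (I → ℝ) := 𝒱.Δ α ∩ 𝒱.Δ β

/-- `Δ_α ∩ Δ_β ∩ Δ_γ`. -/
abbrev Δ₃ (α β γ : SignVector I) : Set (I → ℝ) := 𝒱.Δ α ∩ 𝒱.Δ β ∩ 𝒱.Δ γ

theorem Δ₃_subset_left (α β γ : SignVector I) : 𝒱.Δ₃ α β γ ⊆ 𝒱.Δ₂ α β :=
  fun _ h => h.1

theorem Δ₃_subset_right (α β γ : SignVector I) : 𝒱.Δ₃ α β γ ⊆ 𝒱.Δ₂ β γ :=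
  fun _ h => ⟨h.1.2, h.2⟩

theorem mem_Δ_of_flat {α β γ : SignVector I} {x : I → ℝ} (hα : x ∈ 𝒱.Δ α) (hγ : x ∈ 𝒱.Δ γ)
    (h0 : ∀ i ∈ SignVector.S α β γ, x i = 0) : x ∈ 𝒱.Δ β := by
  refine ⟨hα.1, fun i => ?_⟩
  by_cases hi : i ∈ SignVector.S α β γ
  · rw [h0 i hi, mul_zero]
  · by_cases h : β i = α i
    · rw [h]; exact hα.2 i
    · have hβγ : β i = γ i := by
        simp only [SignVector.S, Finset.mem_filter, Finset.mem_univ, true_and] at hi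
        rcases Int.units_eq_one_or (α i) with h1 | h1 <;>
        rcases Int.units_eq_one_or (β i) with h2 | h2 <;>
        rcases Int.units_eq_one_or (γ i) with h3 | h3 <;> simp_all
      rw [hβγ]; exact hγ.2 i

theorem u_mul_mem (α β γ : SignVector I) {f : MvPolynomial I ℝ}
    (hf : f ∈ 𝒱.idealR (𝒱.Δ₃ α β γ)) :
    u (SignVector.S α β γ) * f ∈ 𝒱.idealR (𝒱.Δ₂ α γ) := by
  classical
  suffices h : 𝒱.idealR (𝒱.Δ₃ α β γ) ≤
      Submodule.comap (LinearMap.mulLeft (MvPolynomial I ℝ) (u (SignVector.S α β γ)))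
        (𝒱.idealR (𝒱.Δ₂ α γ)) from h hf
  refine sup_le (Ideal.span_le.2 ?_) (fun g hg => ?_)
  · rintro _ ⟨T, hT, rfl⟩
    change u (SignVector.S α β γ) * u T ∈ 𝒱.idealR (𝒱.Δ₂ α γ)
    have hmem : u (SignVector.S α β γ ∪ T) ∈ 𝒱.idealR (𝒱.Δ₂ α γ) := by
      refine Ideal.mem_sup_left (Ideal.subset_span ⟨_, ?_, rfl⟩)
      rw [Set.eq_empty_iff_forall_notMem] at hT ⊢
      rintro x ⟨⟨hx, hx0⟩, hα, hγ⟩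
      refine hT x ⟨⟨hx, fun i hi => hx0 i (Finset.mem_union_right _ hi)⟩, ⟨hα, ?_⟩, hγ⟩
      exact 𝒱.mem_Δ_of_flat hα hγ fun i hi => hx0 i (Finset.mem_union_left _ hi)
    refine Ideal.mem_of_dvd _ ?_ hmem
    exact ⟨u (SignVector.S α β γ ∩ T), Finset.prod_union_inter.symm⟩
  · exact Ideal.mul_mem_left _ _ (Ideal.mem_sup_right hg)

/-- The map `R_{αβγ} → R_{αγ}` induced by multiplication by the monomial `u_{S(αβγ)}`. -/
def mulU (α β γ : SignVector I) : 𝒱.R (𝒱.Δ₃ α β γ) →ₗ[ℝ] 𝒱.R (𝒱.Δ₂ α γ) :=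
  Submodule.mapQ ((𝒱.idealR (𝒱.Δ₃ α β γ)).restrictScalars ℝ)
    ((𝒱.idealR (𝒱.Δ₂ α γ)).restrictScalars ℝ) (LinearMap.mulLeft ℝ (u (SignVector.S α β γ)))
    (fun _ hf => 𝒱.u_mul_mem α β γ hf)

/-- The product `R_{αβ} ⊗ R_{βγ} → R_{αγ}`, as a bilinear map: multiply the images in `R_{αβγ}`,
and then apply the multiplication by `u_{S(αβγ)}`. -/
def star (α β γ : SignVector I) :
    𝒱.R (𝒱.Δ₂ α β) →ₗ[ℝ] 𝒱.R (𝒱.Δ₂ β γ) →ₗ[ℝ] 𝒱.R (𝒱.Δ₂ α γ) :=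
  ((LinearMap.mul ℝ (𝒱.R (𝒱.Δ₃ α β γ))).compl₁₂
    (𝒱.quotientMap (𝒱.Δ₃_subset_left α β γ)).toLinearMap
    (𝒱.quotientMap (𝒱.Δ₃_subset_right α β γ)).toLinearMap).compr₂
    (𝒱.mulU α β γ)

theorem star_mk (α β γ : SignVector I) (f g : MvPolynomial I ℝ) :
    𝒱.star α β γ (𝒱.mkR _ f) (𝒱.mkR _ g) =
      𝒱.mkR _ (u (SignVector.S α β γ) * (f * g)) := rfl

theorem u_mul_u (α β γ δ : SignVector I) :
    u (SignVector.S α β γ) * u (SignVector.S α γ δ) =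
      u (SignVector.S β γ δ) * u (SignVector.S α β δ) := by
  classical
  have h : ∀ S : Finset I, u S = ∏ i, (MvPolynomial.X i : MvPolynomial I ℝ) ^
      (if i ∈ S then 1 else 0) := by
    intro S
    simp [u, pow_ite, Finset.prod_ite_mem]
  rw [h, h, h, h, ← Finset.prod_mul_distrib, ← Finset.prod_mul_distrib]
  refine Finset.prod_congr rfl fun i _ => ?_
  rw [← pow_add, ← pow_add, SignVector.S_assoc α β γ δ i]

theorem star_assoc (α β γ δ : SignVector I) (x : 𝒱.R (𝒱.Δ₂ α β)) (y : 𝒱.R (𝒱.Δ₂ β γ))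
    (z : 𝒱.R (𝒱.Δ₂ γ δ)) :
    𝒱.star α γ δ (𝒱.star α β γ x y) z = 𝒱.star α β δ x (𝒱.star β γ δ y z) := by
  obtain ⟨f, rfl⟩ := 𝒱.mkR_surjective _ x
  obtain ⟨g, rfl⟩ := 𝒱.mkR_surjective _ y
  obtain ⟨k, rfl⟩ := 𝒱.mkR_surjective _ z
  rw [star_mk, star_mk, star_mk, star_mk]
  congr 1
  linear_combination (f * g * k) * u_mul_u α β γ δ

theorem one_star (α β : SignVector I) (x : 𝒱.R (𝒱.Δ₂ α β)) : 𝒱.star α α β 1 x = x := by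
  obtain ⟨f, rfl⟩ := 𝒱.mkR_surjective _ x
  have hS : SignVector.S α α β = ∅ := by
    ext i
    simp only [SignVector.S, Finset.mem_filter, Finset.mem_univ, true_and, Finset.notMem_empty,
      iff_false]
    exact fun h => h.2 h.1.symm
  rw [← map_one (𝒱.mkR _), star_mk, hS]
  simp [u]

theorem star_one (α β : SignVector I) (x : 𝒱.R (𝒱.Δ₂ α β)) : 𝒱.star α β β x 1 = x := by
  obtain ⟨f, rfl⟩ := 𝒱.mkR_surjective _ x
  have hS : SignVector.S α β β = ∅ := by
    ext i; simp [SignVector.S]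
  rw [← map_one (𝒱.mkR _), star_mk, hS]
  simp [u]

/-- The direct sum `B(𝒱)` of the `R_{αβ}` over all (finitely many) pairs of bounded feasible sign
vectors. -/
def B : Type _ := (a b : 𝒱.P) → 𝒱.R (𝒱.Δ₂ a b)

namespace B

instance : AddCommGroup 𝒱.B := inferInstanceAs (AddCommGroup ((a b : 𝒱.P) → 𝒱.R (𝒱.Δ₂ a b)))

instance : Module ℝ 𝒱.B := inferInstanceAs (Module ℝ ((a b : 𝒱.P) → 𝒱.R (𝒱.Δ₂ a b)))

instance : Mul 𝒱.B := ⟨fun x y a c => ∑ b : 𝒱.P, 𝒱.star a b c (x a b) (y b c)⟩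

open Classical in
/-- The homomorphism `ζ : Sym ℝ^I → ⊕ R_{αα} ⊆ B`. -/
def ζ (f : MvPolynomial I ℝ) : 𝒱.B := fun a b => if a = b then 𝒱.mkR _ f else 0

open Classical in
/-- The unit element `1_{αβ}` of `R_{αβ}`, as an element of `B`. -/
def unit (a b : 𝒱.P) : 𝒱.B := Pi.single a (Pi.single b 1)

instance : One 𝒱.B := ⟨ζ 𝒱 1⟩

variable {𝒱}

theorem add_apply (x y : 𝒱.B) (a b : 𝒱.P) : (x + y) a b = x a b + y a b := rfl

theorem mul_apply (x y : 𝒱.B) (a c : 𝒱.P) :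
    (x * y) a c = ∑ b : 𝒱.P, 𝒱.star a b c (x a b) (y b c) := rfl

theorem one_apply_self (a : 𝒱.P) : (1 : 𝒱.B) a a = 1 := (if_pos rfl).trans (map_one _)

theorem one_apply_ne {a b : 𝒱.P} (h : a ≠ b) : (1 : 𝒱.B) a b = 0 := if_neg h

instance : Ring 𝒱.B :=
  { (inferInstance : AddCommGroup 𝒱.B),
    (inferInstance : Mul 𝒱.B), (inferInstance : One 𝒱.B) with
    left_distrib := fun x y z => by
      funext a c
      simp only [mul_apply, add_apply, map_add, Finset.sum_add_distrib]
    right_distrib := fun x y z => by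
      funext a c
      simp only [mul_apply, add_apply, map_add, LinearMap.add_apply, Finset.sum_add_distrib]
    zero_mul := fun x => by
      funext a c
      refine Finset.sum_eq_zero fun b _ => ?_
      change 𝒱.star a b c 0 _ = 0
      simp
    mul_zero := fun x => by
      funext a c
      refine Finset.sum_eq_zero fun b _ => ?_
      change 𝒱.star a b c _ 0 = 0
      simp
    mul_assoc := fun x y z => by
      funext a d
      simp only [mul_apply, map_sum, LinearMap.sum_apply, star_assoc]
      exact Finset.sum_comm
    one_mul := fun x => by
      funext a c
      rw [mul_apply, Finset.sum_eq_single a]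
      · rw [one_apply_self, one_star]
      · intro b _ hb
        rw [one_apply_ne hb.symm]; simp
      · simp
    mul_one := fun x => by
      funext a c
      rw [mul_apply, Finset.sum_eq_single c]
      · rw [one_apply_self, star_one]
      · intro b _ hb
        rw [one_apply_ne hb]; simp
      · simp }

instance : Algebra ℝ 𝒱.B :=
  Algebra.ofModule
    (fun r x y => by
      funext a c
      change ∑ b : 𝒱.P, 𝒱.star a b c (r • x a b) (y b c) =
        r • ∑ b : 𝒱.P, 𝒱.star a b c (x a b) (y b c)
      simp [Finset.smul_sum])
    (fun r x y => by
      funext a c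
      change ∑ b : 𝒱.P, 𝒱.star a b c (x a b) (r • y b c) =
        r • ∑ b : 𝒱.P, 𝒱.star a b c (x a b) (y b c)
      simp [Finset.smul_sum])

variable (𝒱)

/-- The degree `n` part of the shifted graded vector space `R_{αβ}[-d_{αβ}]`, i.e. the degree
`n - d_{αβ}` part of `R_{αβ}`. -/
def gradedPieceShifted (α β : SignVector I) (n : ℕ) : Submodule ℝ (𝒱.R (𝒱.Δ₂ α β)) :=
  if SignVector.dist α β ≤ n then 𝒱.gradedPieceR (𝒱.Δ₂ α β) (n - SignVector.dist α β) else ⊥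

/-- The degree `n` part of `B = ⊕ R_{αβ}[-d_{αβ}]`. -/
def gradedPiece (n : ℕ) : Submodule ℝ 𝒱.B where
  carrier := {x | ∀ a b : 𝒱.P, x a b ∈ gradedPieceShifted 𝒱 a b n}
  zero_mem' := fun _ _ => Submodule.zero_mem _
  add_mem' := fun hx hy a b => Submodule.add_mem _ (hx a b) (hy a b)
  smul_mem' := fun r _ hx a b => Submodule.smul_mem _ r (hx a b)

end B

end PolarizedArrangement

end

/-!
# Gale duality between the algebras `A` and `B`

Farkas' lemma (`exists_perp_separating`) identifies the sign vectors that are feasible for the Gale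
dual with those that are bounded for `𝒱`, and conversely (`galeDual_feasible`, `galeDual_bounded`);
hence `𝒫^∨ = 𝒫`, and the vertices of the quiver of `A(𝒱^∨)` are the bounded sign vectors of `𝒱`.

The homomorphism `φ : A(𝒱^∨) → B(𝒱)` sends `p(α, β)` to `1_{αβ}` if both `α` and `β` are feasible,
and to zero otherwise. The relations between paths in `A` follow from one identity,
`1_{αβ} 1_{βγ} = u_{S(αβγ)} 1_{αγ}` for bounded `β` (`B.unitOrZero_mul_unitOrZero`). If `β` is
infeasible, then the left side is zero by definition, and the right side vanishes in `R_{αγ}` since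
`H_{S(αβγ)} ∩ Δ_α ∩ Δ_γ` is contained in `Δ_β`, which is empty.

For the inverse, call a path taut if it crosses each hyperplane at most once. Any two vertices are
joined by a taut path, and all taut paths between them have the same class in `A`
(`A.IsTaut.eq_taut`). To see this, one compares the first steps of two taut paths: these cross facets
of `Δ_α` that are visible from a point of the target chamber, and two visible facets are connected
through codimension two faces (`eq_of_flip_feasible`), i.e. through squares of the quiver. The proof
of the latter covers `Δ_α` by the closed sets of points that are seen through a given facet, and uses
that `Δ_α` is connected. Consequently the classes of taut paths multiply like the `1_{αβ}`
(`A.taut_mul_taut`), and they span `A` over the polynomial ring.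

So `f ↦ f · (taut path from α to β)` defines an inverse of `φ` as soon as it kills the ideal of
`R_{αβ}` (`GaleDuality.polyHom_mul_taut_eq_zero`). Let `H_S ∩ Δ_α ∩ Δ_β = ∅`. Farkas' lemma yields a
bounded but infeasible `δ` that differs from `α` only inside `S` or where `β` does. The walk from `α`
over `δ` to `β` is zero in `A(𝒱^∨)`, and it equals a divisor of `u_S` times the taut path.

Finally, `B` is graded because the ideals of the rings `R_D` are homogeneous; `φ` identifies the
graded pieces, which transfers the grading to `A(𝒱^∨)`.
-/

noncomputable section

/-! ### Separation from a polyhedral cone -/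

section Separation

variable {I : Type*} [Fintype I]

/-- Farkas' lemma for the cone spanned by a subspace `V` and by the vectors `α j • e_j` with
`j ∈ s`: a vector outside the cone is separated from it by a linear form. By induction on `s`, for
all `V` at once: to add `j`, apply the induction hypothesis to `V + ℝ e_j`, and if `x` lies in that
larger cone, to `V` itself. -/
theorem exists_perp_separating (α : I → ℤˣ) (s : Finset I) (V : Submodule ℝ (I → ℝ)) (x : I → ℝ)
    (h : ∀ y, x - y ∈ V → (∀ i ∉ s, y i = 0) → ∃ i ∈ s, ((α i : ℤ) : ℝ) * y i < 0) :
    ∃ w ∈ perp V, (∀ i ∈ s, 0 ≤ ((α i : ℤ) : ℝ) * w i) ∧ ∑ i, w i * x i < 0 := by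
  classical
  induction s using Finset.induction_on generalizing V with
  | empty =>
    have hx : x ∉ perp (perp V) := by
      rw [perp_perp]
      intro hx
      obtain ⟨i, hi, -⟩ := h 0 (by simpa using hx) (fun i _ => rfl)
      simp at hi
    rw [mem_perp] at hx
    push Not at hx
    obtain ⟨w, hw, hwx⟩ := hx
    have hwx' : ∑ i, w i * x i ≠ 0 := by
      simpa only [mul_comm] using hwx
    rcases hwx'.lt_or_gt with h0 | h0
    · exact ⟨w, hw, by simp, h0⟩
    · exact ⟨-w, neg_mem hw, by simp, by simpa using h0⟩
  | insert j s hj ih =>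
    by_cases h1 : ∀ y, x - y ∈ V ⊔ Submodule.span ℝ {Pi.single j (1 : ℝ)} → (∀ i ∉ s, y i = 0) →
        ∃ i ∈ s, ((α i : ℤ) : ℝ) * y i < 0
    · obtain ⟨w, hw, hws, hwx⟩ := ih _ h1
      have hw' := mem_perp.1 hw
      refine ⟨w, mem_perp.2 fun v hv => hw' v (Submodule.mem_sup_left hv), ?_, hwx⟩
      have hwj : w j = 0 := by
        simpa [Pi.single_apply] using
          hw' _ (Submodule.mem_sup_right (Submodule.mem_span_singleton_self _))
      intro i hi
      rcases Finset.mem_insert.1 hi with rfl | hi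
      · simp [hwj]
      · exact hws i hi
    · push Not at h1
      obtain ⟨y, hy, hys, hy0⟩ := h1
      obtain ⟨v, hv, z, hz, hvz⟩ := Submodule.mem_sup.1 hy
      obtain ⟨r, rfl⟩ := Submodule.mem_span_singleton.1 hz
      obtain ⟨w, hw, hws, hwx⟩ := ih V (fun y' hy' hys' => by
        obtain ⟨i, hi, hi0⟩ := h y' hy' (fun i hi => hys' i (fun h' => hi (by simp [h'])))
        rcases Finset.mem_insert.1 hi with rfl | hi
        · rw [hys' i hj, mul_zero] at hi0
          exact absurd hi0 (lt_irrefl _)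
        · exact ⟨i, hi, hi0⟩)
      refine ⟨w, hw, ?_, hwx⟩
      -- `x = v + r e_j + y` lies outside the cone over `insert j s`, so `r` has the wrong sign.
      have hr : ((α j : ℤ) : ℝ) * r < 0 := by
        obtain ⟨i, hi, hi0⟩ := h (y + r • Pi.single j 1) (by
          have : x - (y + r • Pi.single j 1) = v := by rw [← sub_sub, ← hvz]; simp
          rwa [this]) (fun i hi => by
            have hij : i ≠ j := fun h' => hi (by simp [h'])
            simp [hij, hys i (fun h' => hi (by simp [h']))])
        rcases Finset.mem_insert.1 hi with rfl | hi
        · simpa [hys i hj] using hi0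
        · have hij : i ≠ j := fun h' => hj (h' ▸ hi)
          simp only [Pi.add_apply, Pi.smul_apply, Pi.single_eq_of_ne hij, smul_zero,
            add_zero] at hi0
          exact absurd hi0 (not_lt.2 (hy0 i hi))
      have hsum : ∑ i, w i * x i = r * w j + ∑ i, w i * y i := by
        have hx : x = v + r • Pi.single j 1 + y := by rw [hvz]; simp
        have h3 := mem_perp.1 hw v hv
        rw [hx]
        simp only [Pi.add_apply, mul_add, Finset.sum_add_distrib, h3, zero_add]
        simp [Pi.single_apply, mul_comm]
      have hpos : 0 ≤ ∑ i, w i * y i := by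
        refine Finset.sum_nonneg fun i _ => ?_
        by_cases hi : i ∈ s
        · have h4 := mul_nonneg (hws i hi) (hy0 i hi)
          rcases Int.units_eq_one_or (α i) with h5 | h5 <;> simpa [h5] using h4
        · simp [hys i hi]
      intro i hi
      rcases Finset.mem_insert.1 hi with rfl | hi
      · rcases Int.units_eq_one_or (α i) with h5 | h5 <;> simp [h5] at hr ⊢ <;> nlinarith
      · exact hws i hi

/-- The orthant of `α` meets `x + V^⊥` if and only if the linear form `w ↦ -∑ i, x i * w i` is
bounded above on the points of `V` that lie in the orthant. -/
theorem exists_sign_iff_bddAbove (α : I → ℤˣ) (V : Submodule ℝ (I → ℝ)) (x : I → ℝ) :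
    (∃ y, x - y ∈ perp V ∧ ∀ i, 0 ≤ ((α i : ℤ) : ℝ) * y i) ↔
      BddAbove {r | ∃ w ∈ V, (∀ i, 0 ≤ ((α i : ℤ) : ℝ) * w i) ∧ r = -∑ i, x i * w i} := by
  constructor
  · rintro ⟨y, hy, hy0⟩
    refine ⟨0, ?_⟩
    rintro _ ⟨w, hw, hw0, rfl⟩
    have h1 : ∑ i, x i * w i = ∑ i, y i * w i := by
      rw [← sub_eq_zero, ← Finset.sum_sub_distrib, ← mem_perp.1 hy w hw]
      simp [sub_mul]
    rw [neg_nonpos, h1]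
    refine Finset.sum_nonneg fun i _ => ?_
    have h4 := mul_nonneg (hy0 i) (hw0 i)
    rcases Int.units_eq_one_or (α i) with h5 | h5 <;> simpa [h5] using h4
  · rintro ⟨M, hM⟩
    by_contra! hne
    obtain ⟨w, hw, hw0, hwx⟩ := exists_perp_separating α Finset.univ (perp V) x
      (fun y hy _ => by simpa using hne y hy)
    rw [perp_perp] at hw
    have hx : 0 < -∑ i, x i * w i := by
      simpa only [mul_comm, neg_pos] using hwx
    obtain ⟨n, hn⟩ := exists_nat_gt (M / (-∑ i, x i * w i))
    rw [div_lt_iff₀ hx] at hn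
    refine absurd (hM ⟨(n : ℝ) • w, V.smul_mem _ hw, fun i => ?_, rfl⟩) (not_le.2 ?_)
    · have := mul_nonneg n.cast_nonneg (hw0 i (Finset.mem_univ _))
      simpa [mul_left_comm] using this
    · refine hn.trans_eq ?_
      simp [Finset.mul_sum, mul_left_comm]

end Separation

/-! ### Sign vectors -/

namespace SignVector

variable {I : Type*}

open Classical in
/-- The sign vector `α` with its `i`-th entry negated. -/
def flip (i : I) (α : SignVector I) : SignVector I := Function.update α i (-α i)

@[simp] theorem flip_self (i : I) (α : SignVector I) : flip i α i = -α i := by simp [flip]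

theorem flip_of_ne {i j : I} (h : j ≠ i) (α : SignVector I) : flip i α j = α j := by
  simp [flip, h]

theorem neg_ne_self (a : ℤˣ) : -a ≠ a := by
  rcases Int.units_eq_one_or a with h | h <;> rw [h] <;> decide

theorem eq_neg_of_ne {a b : ℤˣ} (h : a ≠ b) : b = -a := by
  rcases Int.units_eq_one_or a with h1 | h1 <;> rcases Int.units_eq_one_or b with h2 | h2 <;>
    simp_all

theorem adjAt_flip (i : I) (α : SignVector I) : AdjAt i α (flip i α) := by
  intro j
  by_cases h : j = i
  · subst h
    simp [(neg_ne_self (α j)).symm]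
  · simp [flip_of_ne h, h]

theorem AdjAt.symm {i : I} {α β : SignVector I} (h : AdjAt i α β) : AdjAt i β α :=
  fun j => ne_comm.trans (h j)

theorem AdjAt.eq_flip {i : I} {α β : SignVector I} (h : AdjAt i α β) : β = flip i α := by
  funext j
  by_cases hj : j = i
  · subst hj
    rw [flip_self]
    exact eq_neg_of_ne ((h j).2 rfl)
  · rw [flip_of_ne hj]
    by_contra h'
    exact hj ((h j).1 (Ne.symm h'))

theorem flip_comm (i j : I) (α : SignVector I) : flip i (flip j α) = flip j (flip i α) := by
  funext k
  by_cases hi : k = i <;> by_cases hj : k = j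
  · subst hi; subst hj; rfl
  · subst hi; simp [flip_of_ne hj]
  · subst hj; simp [flip_of_ne hi]
  · simp [flip_of_ne hi, flip_of_ne hj]

variable [Fintype I]

theorem dist_eq_zero {α β : SignVector I} (h : dist α β = 0) : α = β := by
  funext i
  by_contra hi
  have : i ∈ Finset.univ.filter fun i => α i ≠ β i := by simp [hi]
  rw [Finset.card_eq_zero.1 h] at this
  simp at this

@[simp] theorem dist_self (α : SignVector I) : dist α α = 0 := by simp [dist]

theorem dist_flip {i : I} {α β : SignVector I} (h : α i ≠ β i) :
    dist (flip i α) β + 1 = dist α β := by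
  classical
  have hs : (Finset.univ.filter fun j => α j ≠ β j) =
      insert i (Finset.univ.filter fun j => flip i α j ≠ β j) := by
    ext j
    by_cases hj : j = i
    · subst hj; simp [h]
    · simp [hj, flip_of_ne hj]
  rw [dist, dist, hs, Finset.card_insert_of_notMem]
  simp [eq_neg_of_ne h]

theorem dist_of_adj {α β : SignVector I} (h : Adj α β) : dist α β = 1 := by
  obtain ⟨i, hi⟩ := h
  rw [dist, Finset.card_eq_one]
  exact ⟨i, by ext j; simp [hi j]⟩

theorem dist_add_dist (α β γ : SignVector I) :
    dist α β + dist β γ = dist α γ + 2 * (S α β γ).card := by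
  simp only [dist, S, Finset.card_filter, Finset.mul_sum, ← Finset.sum_add_distrib]
  refine Finset.sum_congr rfl fun i _ => ?_
  rcases Int.units_eq_one_or (α i) with h1 | h1 <;> rcases Int.units_eq_one_or (β i) with h2 | h2 <;>
  rcases Int.units_eq_one_or (γ i) with h3 | h3 <;> simp [h1, h2, h3]

theorem S_eq_empty {α β γ : SignVector I} (h : ∀ i, α i ≠ β i → β i = γ i) : S α β γ = ∅ := by
  ext i
  simp only [S, Finset.mem_filter, Finset.mem_univ, true_and, Finset.notMem_empty, iff_false]
  rintro ⟨h1, h2⟩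
  exact h2 (h i fun h3 => h2 (h1 ▸ h3)).symm

theorem AdjAt.S_eq_empty {i : I} {α β γ : SignVector I} (h : AdjAt i α β) (hi : α i ≠ γ i) :
    S α β γ = ∅ := by
  refine SignVector.S_eq_empty fun j hj => ?_
  obtain rfl := (h j).1 hj
  rw [eq_neg_of_ne hj, eq_neg_of_ne hi]

theorem AdjAt.S_eq_singleton {i : I} {α β γ : SignVector I} (h : AdjAt i α β) (hi : α i = γ i) :
    S α β γ = {i} := by
  ext j
  simp only [S, Finset.mem_filter, Finset.mem_univ, true_and, Finset.mem_singleton]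
  constructor
  · rintro ⟨h1, h2⟩
    exact (h j).1 fun h3 => h2 (h1 ▸ h3)
  · rintro rfl
    exact ⟨hi, hi ▸ (h j).2 rfl⟩

end SignVector

namespace PolarizedArrangement

variable {I : Type*} [Fintype I] (𝒱 : PolarizedArrangement I)

/-! ### Gale duality of chambers -/

theorem sub_mem_iff_mkQ_eq {I : Type*} {V : Submodule ℝ (I → ℝ)} {x y : I → ℝ} :
    x - y ∈ V ↔ V.mkQ y = V.mkQ x := by
  rw [eq_comm]
  exact (Submodule.Quotient.eq V).symm

theorem galeDual_feasible : 𝒱.galeDual.feasible = 𝒱.bounded := by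
  ext α
  obtain ⟨w, hw⟩ := dotRestrict_surjective 𝒱.V 𝒱.ξ
  have hη : 𝒱.galeDual.η = (perp 𝒱.V).mkQ (-w) := by
    change -(quotPerpEquiv 𝒱.V).symm 𝒱.ξ = _
    rw [map_neg, neg_inj, LinearEquiv.symm_apply_eq, ← hw]
    rfl
  have h1 : α ∈ 𝒱.galeDual.feasible ↔
      ∃ y, -w - y ∈ perp 𝒱.V ∧ ∀ i, 0 ≤ ((α i : ℤ) : ℝ) * y i := by
    refine exists_congr fun y => and_congr ?_ Iff.rfl
    rw [sub_mem_iff_mkQ_eq, ← hη]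
    rfl
  have h2 : 𝒱.ξ '' 𝒱.cone α =
      {r | ∃ v ∈ 𝒱.V, (∀ i, 0 ≤ ((α i : ℤ) : ℝ) * v i) ∧ r = -∑ i, (-w) i * v i} := by
    ext r
    constructor
    · rintro ⟨v, hv, rfl⟩
      refine ⟨v, v.2, hv, ?_⟩
      rw [← hw, dotRestrict_apply]
      simp
    · rintro ⟨v, hv, hv0, rfl⟩
      refine ⟨⟨v, hv⟩, hv0, ?_⟩
      rw [← hw, dotRestrict_apply]
      simp
  rw [h1, exists_sign_iff_bddAbove, ← h2]
  rfl

theorem galeDual_bounded : 𝒱.galeDual.bounded = 𝒱.feasible := by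
  ext α
  obtain ⟨x, hx⟩ := 𝒱.V.mkQ_surjective 𝒱.η
  have h1 : α ∈ 𝒱.feasible ↔
      ∃ y, x - y ∈ perp (perp 𝒱.V) ∧ ∀ i, 0 ≤ ((α i : ℤ) : ℝ) * y i := by
    refine exists_congr fun y => and_congr ?_ Iff.rfl
    rw [perp_perp, sub_mem_iff_mkQ_eq, hx]
    rfl
  have hξ : ∀ v : perp 𝒱.V, 𝒱.galeDual.ξ v = -∑ i, x i * (v : I → ℝ) i := by
    intro v
    change (-quotToDualPerp 𝒱.V 𝒱.η) v = _
    rw [← hx]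
    rfl
  have h2 : 𝒱.galeDual.ξ '' 𝒱.galeDual.cone α =
      {r | ∃ v ∈ perp 𝒱.V, (∀ i, 0 ≤ ((α i : ℤ) : ℝ) * v i) ∧ r = -∑ i, x i * v i} := by
    ext r
    constructor
    · rintro ⟨v, hv, rfl⟩
      exact ⟨v, v.2, hv, hξ v⟩
    · rintro ⟨v, hv, hv0, rfl⟩
      exact ⟨⟨v, hv⟩, hv0, hξ _⟩
  rw [h1, exists_sign_iff_bddAbove, ← h2]
  rfl

theorem galeDual_P : 𝒱.galeDual.P = 𝒱.P := by
  rw [P, P, galeDual_feasible, galeDual_bounded, Set.inter_comm]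

/-- If the flat `H_T` misses `Δ_α`, then `α` can be modified inside `T` to a sign vector that is
infeasible, while it stays feasible for the Gale dual: add a large multiple of a form `w ∈ V^⊥` that
separates `η` to a point of the dual chamber of `α`. -/
theorem exists_galeDual_feasible_not_feasible {α : SignVector I} (T : Finset I)
    (hα : α ∈ 𝒱.galeDual.feasible) (hT : 𝒱.flat T ∩ 𝒱.Δ α = ∅) :
    ∃ δ ∈ 𝒱.galeDual.feasible, δ ∉ 𝒱.feasible ∧ ∀ i, α i ≠ δ i → i ∈ T := by
  classical
  obtain ⟨x, hx⟩ := 𝒱.V.mkQ_surjective 𝒱.η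
  obtain ⟨w, hw, hw0, hwx⟩ := exists_perp_separating α Tᶜ 𝒱.V x (fun y hy hyT => by
    by_contra! hy0
    rw [sub_mem_iff_mkQ_eq, hx] at hy
    refine (Set.eq_empty_iff_forall_notMem.1 hT) y
      ⟨⟨hy, fun i hi => hyT i (by simpa using hi)⟩, hy, fun i => ?_⟩
    by_cases hi : i ∈ T
    · simp [hyT i (by simpa using hi)]
    · exact hy0 i (by simpa using hi))
  obtain ⟨y, hy, hy0⟩ := hα
  set δ : SignVector I := fun i => if 0 ≤ ((α i : ℤ) : ℝ) * w i then α i else -α i with hδ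
  have hδw : ∀ i, 0 ≤ ((δ i : ℤ) : ℝ) * w i := by
    intro i
    by_cases h : 0 ≤ ((α i : ℤ) : ℝ) * w i
    · simp [hδ, h]
    · simp [hδ, h, (not_le.1 h).le]
  refine ⟨δ, ?_, ?_, ?_⟩
  · have hev : ∀ i, ∀ᶠ r : ℝ in Filter.atTop, 0 ≤ ((δ i : ℤ) : ℝ) * (y i + r * w i) := by
      intro i
      by_cases h : 0 ≤ ((α i : ℤ) : ℝ) * w i
      · filter_upwards [Filter.eventually_ge_atTop 0] with r hr
        have h1 : δ i = α i := by simp [hδ, h]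
        rw [h1, mul_add, mul_left_comm]
        exact add_nonneg (hy0 i) (mul_nonneg hr h)
      · have h1 : δ i = -α i := by simp [hδ, h]
        have h2 : 0 < -(((α i : ℤ) : ℝ) * w i) := by linarith [not_le.1 h]
        filter_upwards [Filter.eventually_ge_atTop
          (((α i : ℤ) : ℝ) * y i / -(((α i : ℤ) : ℝ) * w i))] with r hr
        rw [div_le_iff₀ h2] at hr
        rw [h1]
        push_cast
        linarith
    obtain ⟨r, hr⟩ := (Filter.eventually_all.2 hev).exists
    refine ⟨y + r • w, ?_, hr⟩
    have hw' : (perp 𝒱.V).mkQ (r • w) = 0 := by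
      rw [Submodule.mkQ_apply, Submodule.Quotient.mk_eq_zero]
      exact Submodule.smul_mem _ _ hw
    change (perp 𝒱.V).mkQ (y + r • w) = _
    rw [map_add, hw', add_zero]
    exact hy
  · rintro ⟨z, hz, hz0⟩
    have hxz : x - z ∈ 𝒱.V := by
      rw [sub_mem_iff_mkQ_eq, hx]
      exact hz
    have h1 : ∑ i, w i * x i = ∑ i, w i * z i := by
      rw [← sub_eq_zero, ← Finset.sum_sub_distrib, ← mem_perp.1 hw _ hxz]
      simp [mul_sub]
    rw [h1] at hwx
    refine absurd hwx (not_lt.2 (Finset.sum_nonneg fun i _ => ?_))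
    have h4 := mul_nonneg (hδw i) (hz0 i)
    rcases Int.units_eq_one_or (δ i) with h5 | h5 <;> simpa [h5] using h4
  · intro i hi
    by_contra hiT
    exact hi (by simp [hδ, hw0 i (by simpa using hiT)])

/-! ### Shortest walks between chambers -/

variable {𝒱}

theorem mem_Δ_of_eq_zero {α γ : SignVector I} {x : I → ℝ} (hx : x ∈ 𝒱.Δ α)
    (h : ∀ i, α i ≠ γ i → x i = 0) : x ∈ 𝒱.Δ γ := by
  refine ⟨hx.1, fun i => ?_⟩
  by_cases hi : α i = γ i
  · rw [← hi]; exact hx.2 i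
  · simp [h i hi]

theorem combination_mem_space {x y : I → ℝ} (hx : x ∈ 𝒱.space) (hy : y ∈ 𝒱.space) {r s : ℝ}
    (hrs : r + s = 1) : r • x + s • y ∈ 𝒱.space := by
  change 𝒱.V.mkQ _ = _
  rw [map_add, map_smul, map_smul, show 𝒱.V.mkQ x = _ from hx, show 𝒱.V.mkQ y = _ from hy,
    ← add_smul, hrs, one_smul]

theorem convex_Δ (α : SignVector I) : Convex ℝ (𝒱.Δ α) := by
  intro x hx y hy r s hr hs hrs
  refine ⟨combination_mem_space hx.1 hy.1 hrs, fun i => ?_⟩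
  have h1 := mul_nonneg hr (hx.2 i)
  have h2 := mul_nonneg hs (hy.2 i)
  simp only [Pi.add_apply, Pi.smul_apply, smul_eq_mul]
  linarith

/-- The point where the segment from `y` to `z ∈ Δ_α` enters `Δ_α`, if the facet `i` is the last one
of the separating facets to be crossed. -/
theorem exists_entry_point {α : SignVector I} {y z : I → ℝ} (hy : y ∈ 𝒱.space) (hz : z ∈ 𝒱.Δ α)
    {i : I} (hi : ((α i : ℤ) : ℝ) * y i < 0)
    (hmin : ∀ k, ((α k : ℤ) : ℝ) * y k < 0 →
      (((α k : ℤ) : ℝ) * y k) * (((α i : ℤ) : ℝ) * z i) ≥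
        (((α i : ℤ) : ℝ) * y i) * (((α k : ℤ) : ℝ) * z k)) :
    ∃ e ∈ 𝒱.Δ α, ∀ k, ((α k : ℤ) : ℝ) * y k * (((α i : ℤ) : ℝ) * z i) =
      (((α i : ℤ) : ℝ) * y i) * (((α k : ℤ) : ℝ) * z k) → e k = 0 := by
  set a := ((α i : ℤ) : ℝ) * z i with ha
  set b := ((α i : ℤ) : ℝ) * y i with hb
  have ha0 : 0 ≤ a := hz.2 i
  have hab : 0 < a - b := by linarith
  have hk : ∀ k, ((α k : ℤ) : ℝ) * ((-b / (a - b)) • z + (a / (a - b)) • y) k =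
      ((((α k : ℤ) : ℝ) * y k) * a - b * (((α k : ℤ) : ℝ) * z k)) / (a - b) := by
    intro k
    simp only [Pi.add_apply, Pi.smul_apply, smul_eq_mul]
    field_simp
    ring
  refine ⟨(-b / (a - b)) • z + (a / (a - b)) • y, ⟨combination_mem_space hz.1 hy ?_, fun k => ?_⟩,
    fun k h => ?_⟩
  · field_simp
    ring
  · rw [hk]
    refine div_nonneg ?_ hab.le
    by_cases h : ((α k : ℤ) : ℝ) * y k < 0
    · linarith [hmin k h]
    · nlinarith [hz.2 k, mul_nonneg (not_lt.1 h) ha0, mul_nonneg (neg_pos.2 hi).le (hz.2 k)]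
  · have h1 := hk k
    rw [h, sub_self, zero_div] at h1
    refine (mul_eq_zero.1 h1).resolve_left ?_
    rcases Int.units_eq_one_or (α k) with h5 | h5 <;> simp [h5]

/-- Among the hyperplanes that separate `y` from `Δ_α`, there is one that the segment from `y` to
`z ∈ Δ_α` crosses last. -/
theorem exists_last_crossing (α : SignVector I) (y : I → ℝ) {z : I → ℝ}
    (hN : ∃ k, ((α k : ℤ) : ℝ) * y k < 0) :
    ∃ i, ((α i : ℤ) : ℝ) * y i < 0 ∧ ∀ k, ((α k : ℤ) : ℝ) * y k < 0 →
      (((α k : ℤ) : ℝ) * y k) * (((α i : ℤ) : ℝ) * z i) ≥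
        (((α i : ℤ) : ℝ) * y i) * (((α k : ℤ) : ℝ) * z k) := by
  classical
  obtain ⟨i, hi, hmin⟩ := Finset.exists_min_image
    (Finset.univ.filter fun k => ((α k : ℤ) : ℝ) * y k < 0)
    (fun k => (((α k : ℤ) : ℝ) * z k) / -(((α k : ℤ) : ℝ) * y k))
    (hN.imp fun k hk => by simpa using hk)
  simp only [Finset.mem_filter, Finset.mem_univ, true_and] at hi hmin
  refine ⟨i, hi, fun k hk => ?_⟩
  have h1 := hmin k hk
  rw [div_le_div_iff₀ (by linarith) (by linarith)] at h1
  linarith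

theorem ne_of_sign_mul_neg {α β : SignVector I} {y : I → ℝ} (hy : y ∈ 𝒱.Δ β) {k : I}
    (hk : ((α k : ℤ) : ℝ) * y k < 0) : α k ≠ β k :=
  fun h => absurd hk (not_lt.2 (h ▸ hy.2 k))

theorem eq_zero_of_sign_mul_nonneg {α β : SignVector I} {y : I → ℝ} (hy : y ∈ 𝒱.Δ β) {k : I}
    (hk : ¬((α k : ℤ) : ℝ) * y k < 0) (hne : α k ≠ β k) : y k = 0 := by
  have h1 := hy.2 k
  rw [SignVector.eq_neg_of_ne hne] at h1
  rcases Int.units_eq_one_or (α k) with h5 | h5 <;> simp [h5] at h1 hk <;> linarith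

theorem flip_mem_feasible {α : SignVector I} {x : I → ℝ} (hx : x ∈ 𝒱.Δ α) {i : I} (hi : x i = 0) :
    SignVector.flip i α ∈ 𝒱.feasible := by
  refine ⟨x, mem_Δ_of_eq_zero hx fun j hj => ?_⟩
  rw [(SignVector.adjAt_flip i α j).1 hj, hi]

theorem flip_flip_mem_feasible {α : SignVector I} {x : I → ℝ} (hx : x ∈ 𝒱.Δ α) {i j : I}
    (hi : x i = 0) (hj : x j = 0) : SignVector.flip j (SignVector.flip i α) ∈ 𝒱.feasible := by
  refine flip_mem_feasible (mem_Δ_of_eq_zero hx fun k hk => ?_) hj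
  rw [(SignVector.adjAt_flip i α k).1 hk, hi]

/-- Two distinct chambers can be joined by a walk that starts by crossing a separating
hyperplane. -/
theorem exists_flip_feasible {α β : SignVector I} (hα : α ∈ 𝒱.feasible) (hβ : β ∈ 𝒱.feasible)
    (hne : α ≠ β) : ∃ i, α i ≠ β i ∧ SignVector.flip i α ∈ 𝒱.feasible := by
  obtain ⟨z, hz⟩ := hα
  obtain ⟨y, hy⟩ := hβ
  by_cases hN : ∃ k, ((α k : ℤ) : ℝ) * y k < 0
  · obtain ⟨i, hi, hmin⟩ := exists_last_crossing α y (z := z) hN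
    obtain ⟨e, he, he0⟩ := exists_entry_point hy.1 hz hi hmin
    exact ⟨i, ne_of_sign_mul_neg hy hi, flip_mem_feasible he (he0 i rfl)⟩
  · push Not at hN
    obtain ⟨i, hi⟩ := Function.ne_iff.1 hne
    exact ⟨i, hi, flip_mem_feasible (α := α) (x := y) ⟨hy.1, hN⟩
      (eq_zero_of_sign_mul_nonneg hy (not_lt.2 (hN i)) hi)⟩

theorem exists_eq_zero_of_flip_feasible {α : SignVector I} {i : I} (hα : α ∈ 𝒱.feasible)
    (hi : SignVector.flip i α ∈ 𝒱.feasible) : ∃ z ∈ 𝒱.Δ α, z i = 0 := by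
  obtain ⟨z, hz⟩ := hα
  obtain ⟨y, hy⟩ := hi
  by_cases hyi : ((α i : ℤ) : ℝ) * y i < 0
  · obtain ⟨e, he, he0⟩ := exists_entry_point hy.1 hz hyi (fun k hk => by
      obtain rfl := (SignVector.adjAt_flip i α k).1 (ne_of_sign_mul_neg hy hk)
      exact le_rfl)
    exact ⟨e, he, he0 i rfl⟩
  · have h0 : y i = 0 := eq_zero_of_sign_mul_nonneg hy hyi ((SignVector.adjAt_flip i α i).2 rfl)
    refine ⟨y, mem_Δ_of_eq_zero hy fun k hk => ?_, h0⟩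
    rwa [(SignVector.adjAt_flip i α k).1 hk.symm]

/-- The facets of `Δ_α` that are visible from a point `y ∈ Δ_β` are connected through faces of
codimension two: a function `Q` on them is constant if it agrees on any two facets `i` and `j` that
have a chamber `flip j (flip i α)` across their intersection. Indeed, the set of all `z ∈ Δ_α` such
that the segment from `y` to `z` enters through a given facet is closed, these finitely many sets
cover the connected set `Δ_α`, and where two of them meet, the entry point lies on both facets. -/
theorem eq_of_flip_feasible {X : Type*} {α β : SignVector I} (hα : α ∈ 𝒱.feasible)
    (hβ : β ∈ 𝒱.feasible) (Q : I → X)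
    (hQ : ∀ i j, i ≠ j → α i ≠ β i → α j ≠ β j → SignVector.flip i α ∈ 𝒱.feasible →
      SignVector.flip j α ∈ 𝒱.feasible →
      SignVector.flip j (SignVector.flip i α) ∈ 𝒱.feasible → Q i = Q j)
    {i j : I} (hi : α i ≠ β i) (hj : α j ≠ β j) (hiF : SignVector.flip i α ∈ 𝒱.feasible)
    (hjF : SignVector.flip j α ∈ 𝒱.feasible) : Q i = Q j := by
  classical
  have H : ∀ e ∈ 𝒱.Δ α, ∀ k l, α k ≠ β k → α l ≠ β l → e k = 0 → e l = 0 → Q k = Q l := by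
    intro e he k l hk hl hk0 hl0
    by_cases hkl : k = l
    · rw [hkl]
    · exact hQ k l hkl hk hl (flip_mem_feasible he hk0) (flip_mem_feasible he hl0)
        (flip_flip_mem_feasible he hk0 hl0)
  obtain ⟨y, hy⟩ := hβ
  by_cases hN : ∃ k, ((α k : ℤ) : ℝ) * y k < 0
  swap
  -- If no hyperplane separates `y` strictly from `Δ_α`, then `y` lies on all the visible facets.
  · push Not at hN
    exact H y ⟨hy.1, hN⟩ i j hi hj (eq_zero_of_sign_mul_nonneg hy (not_lt.2 (hN i)) hi)
      (eq_zero_of_sign_mul_nonneg hy (not_lt.2 (hN j)) hj)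
  -- `C i` contains the `z ∈ Δ_α` such that the segment from `y` to `z` enters `Δ_α` through `i`.
  set C : I → Set (I → ℝ) := fun i => {z | ∀ k, ((α k : ℤ) : ℝ) * y k < 0 →
    (((α k : ℤ) : ℝ) * y k) * (((α i : ℤ) : ℝ) * z i) ≥
      (((α i : ℤ) : ℝ) * y i) * (((α k : ℤ) : ℝ) * z k)} with hC
  have hclosed : ∀ i, IsClosed (C i) := by
    intro i
    simp only [hC, Set.ofPred_forall]
    refine isClosed_iInter fun k => isClosed_iInter fun _ => isClosed_le ?_ ?_ <;> fun_prop
  -- Only the hyperplanes that separate `y` strictly from `Δ_α` are used in the cover; a visible facet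
  -- whose hyperplane contains `y` is compared to one of them first.
  have exists_strict : ∀ i, α i ≠ β i → SignVector.flip i α ∈ 𝒱.feasible →
      ∃ k, ((α k : ℤ) : ℝ) * y k < 0 ∧ (∃ z ∈ 𝒱.Δ α, z ∈ C k) ∧ Q i = Q k := by
    intro i hi hiF
    obtain ⟨z, hz, hzi⟩ := exists_eq_zero_of_flip_feasible hα hiF
    by_cases hiN : ((α i : ℤ) : ℝ) * y i < 0
    · refine ⟨i, hiN, ⟨z, hz, fun k hk => ?_⟩, rfl⟩
      rw [hzi, mul_zero, mul_zero, ge_iff_le]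
      exact mul_nonpos_of_nonpos_of_nonneg hiN.le (hz.2 k)
    · obtain ⟨k, hk, hmin⟩ := exists_last_crossing α y (z := z) hN
      obtain ⟨e, he, he0⟩ := exists_entry_point hy.1 hz hk hmin
      refine ⟨k, hk, ⟨z, hz, hmin⟩, H e he i k hi (ne_of_sign_mul_neg hy hk) (he0 i ?_) (he0 k rfl)⟩
      rw [hzi, eq_zero_of_sign_mul_nonneg hy hiN hi]
      simp
  have eq_of_strict : ∀ k l, ((α k : ℤ) : ℝ) * y k < 0 → ((α l : ℤ) : ℝ) * y l < 0 →
      (∃ z ∈ 𝒱.Δ α, z ∈ C k) → (∃ z ∈ 𝒱.Δ α, z ∈ C l) → Q k = Q l := by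
    rintro k l hk hl ⟨z, hz, hzk⟩ ⟨z', hz', hzl⟩
    by_contra hkl
    set N : Finset I := Finset.univ.filter fun m => ((α m : ℤ) : ℝ) * y m < 0 with hNdef
    obtain ⟨x, hx, hx1, hx2⟩ := isPreconnected_closed_iff.1 (convex_Δ (𝒱 := 𝒱) α).isPreconnected
      (⋃ m ∈ N.filter fun m => Q m = Q k, C m) (⋃ m ∈ N.filter fun m => Q m ≠ Q k, C m)
      (isClosed_biUnion_finset fun m _ => hclosed m)
      (isClosed_biUnion_finset fun m _ => hclosed m)
      (fun x hx => by
        obtain ⟨m, hm, hmin⟩ := exists_last_crossing α y (z := x) hN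
        by_cases hQm : Q m = Q k
        · exact Or.inl (Set.mem_biUnion (x := m) (by simp [hNdef, hm, hQm]) hmin)
        · exact Or.inr (Set.mem_biUnion (x := m) (by simp [hNdef, hm, hQm]) hmin))
      ⟨z, hz, Set.mem_biUnion (x := k) (by simp [hNdef, hk]) hzk⟩
      ⟨z', hz', Set.mem_biUnion (x := l) (by simp [hNdef, hl, Ne.symm hkl]) hzl⟩
    simp only [Set.mem_iUnion, Finset.mem_filter, hNdef, Finset.mem_univ, true_and] at hx1 hx2
    obtain ⟨m, ⟨hm, hQm⟩, hxm⟩ := hx1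
    obtain ⟨n, ⟨hn, hQn⟩, hxn⟩ := hx2
    obtain ⟨e, he, he0⟩ := exists_entry_point hy.1 hx hm hxm
    refine hQn (hQm ▸ H e he n m (ne_of_sign_mul_neg hy hn) (ne_of_sign_mul_neg hy hm)
      (he0 n ?_) (he0 m rfl))
    exact le_antisymm (hxn m hm) (hxm n hn)
  obtain ⟨k, hk, hzk, hQk⟩ := exists_strict i hi hiF
  obtain ⟨l, hl, hzl, hQl⟩ := exists_strict j hj hjF
  rw [hQk, hQl, eq_of_strict k l hk hl hzk hzl]

end PolarizedArrangement

/-! ### The universal property of the path algebra -/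

namespace PathAlgebra

variable {Q : Type*} [Quiver Q]

theorem ofPath_apply_self {a b : Q} (p : Quiver.Path a b) :
    ofPath p a b = Finsupp.single p 1 := by
  simp [ofPath]

theorem ofPath_apply_ne_left {a b a' b' : Q} (p : Quiver.Path a b) (h : a' ≠ a) :
    ofPath p a' b' = 0 := by
  classical
  simp [ofPath, Pi.single_eq_of_ne h]

theorem ofPath_apply_ne_right {a b a' b' : Q} (p : Quiver.Path a b) (h : b' ≠ b) :
    ofPath p a' b' = 0 := by
  classical
  by_cases ha : a' = a
  · subst ha
    simp [ofPath, Pi.single_eq_of_ne h]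
  · exact ofPath_apply_ne_left p ha

theorem ofPath_mem_gradedPiece {a b : Q} (p : Quiver.Path a b) :
    ofPath p ∈ gradedPiece Q p.length := by
  classical
  intro a' b' q hq
  by_cases ha : a' = a
  · subst ha
    by_cases hb : b' = b
    · subst hb
      rw [ofPath_apply_self, Finsupp.single_apply] at hq
      by_contra h
      exact hq (if_neg fun h' => h (by rw [h']))
    · exact absurd (by rw [ofPath_apply_ne_right p hb]; rfl) hq
  · exact absurd (by rw [ofPath_apply_ne_left p ha]; rfl) hq

variable [Fintype Q]

theorem ofPath_mul_ofPath {a b c : Q} (p : Quiver.Path a b) (q : Quiver.Path b c) :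
    ofPath p * ofPath q = ofPath (p.comp q) := by
  funext a' c'
  rw [mul_apply, Finset.sum_eq_single b]
  · by_cases ha : a' = a
    · subst ha
      by_cases hc : c' = c
      · subst hc
        simp [ofPath_apply_self]
      · simp [ofPath_apply_ne_right _ hc]
    · simp [ofPath_apply_ne_left _ ha]
  · intro b' _ hb
    simp [ofPath_apply_ne_left q hb]
  · simp

theorem ofPath_mul_ofPath_of_ne {a b b' c : Q} (p : Quiver.Path a b) (q : Quiver.Path b' c)
    (h : b ≠ b') : ofPath p * ofPath q = 0 := by
  funext a' c'
  rw [mul_apply]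
  refine Finset.sum_eq_zero fun d _ => ?_
  by_cases hd : d = b
  · subst hd
    simp [ofPath_apply_ne_left q h]
  · simp [ofPath_apply_ne_right p hd]

/-- The element of the path algebra with a prescribed `(a, b)`-component and no other component. -/
def component (a b : Q) : (Quiver.Path a b →₀ ℝ) →ₗ[ℝ] PathAlgebra Q :=
  Finsupp.lsum ℝ fun p => LinearMap.toSpanSingleton ℝ _ (ofPath p)

theorem component_eq (a b : Q) (x : Quiver.Path a b →₀ ℝ) :
    component a b x a b = x := by
  induction x using Finsupp.induction_linear with
  | zero => simp only [map_zero]; rfl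
  | add x y hx hy => rw [map_add, add_apply, hx, hy]
  | single p r =>
    simp only [component, Finsupp.lsum_single, LinearMap.toSpanSingleton_apply]
    change r • ofPath p a b = _
    simp [ofPath_apply_self]

theorem component_ne {a b a' b' : Q} (x : Quiver.Path a b →₀ ℝ) (h : a' ≠ a ∨ b' ≠ b) :
    component a b x a' b' = 0 := by
  induction x using Finsupp.induction_linear with
  | zero => simp only [map_zero]; rfl
  | add x y hx hy => rw [map_add, add_apply, hx, hy, add_zero]
  | single p r =>
    simp only [component, Finsupp.lsum_single, LinearMap.toSpanSingleton_apply]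
    change r • ofPath p a' b' = _
    rcases h with h | h
    · simp [ofPath_apply_ne_left p h]
    · simp [ofPath_apply_ne_right p h]

theorem sum_apply {ι : Type*} (s : Finset ι) (f : ι → PathAlgebra Q) (a b : Q) :
    (∑ i ∈ s, f i) a b = ∑ i ∈ s, f i a b := by
  change (LinearMap.proj b ∘ₗ LinearMap.proj a :
    ((a b : Q) → (Quiver.Path a b →₀ ℝ)) →ₗ[ℝ] _) (∑ i ∈ s, f i : PathAlgebra Q) = _
  exact map_sum (LinearMap.proj b ∘ₗ LinearMap.proj a :
    ((a b : Q) → (Quiver.Path a b →₀ ℝ)) →ₗ[ℝ] _) f s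

theorem sum_component (x : PathAlgebra Q) : ∑ a, ∑ b, component a b (x a b) = x := by
  classical
  funext a b
  rw [sum_apply, Finset.sum_eq_single a, sum_apply, Finset.sum_eq_single b, component_eq]
  · intro b' _ hb
    exact component_ne _ (Or.inr hb.symm)
  · simp
  · intro a' _ ha
    rw [sum_apply]
    exact Finset.sum_eq_zero fun b' _ => component_ne _ (Or.inl ha.symm)
  · simp

@[elab_as_elim]
theorem induction_on {motive : PathAlgebra Q → Prop} (x : PathAlgebra Q) (zero : motive 0)
    (add : ∀ x y, motive x → motive y → motive (x + y))
    (smul : ∀ (r : ℝ) (x), motive x → motive (r • x))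
    (ofPath : ∀ (a b : Q) (p : Quiver.Path a b), motive (ofPath p)) : motive x := by
  classical
  rw [← sum_component x]
  refine Finset.sum_induction _ motive add zero fun a _ => ?_
  refine Finset.sum_induction _ motive add zero fun b _ => ?_
  generalize x a b = y
  induction y using Finsupp.induction_linear with
  | zero => simpa only [map_zero] using zero
  | add x y hx hy => rw [map_add]; exact add _ _ hx hy
  | single p r =>
    simp only [component, Finsupp.lsum_single, LinearMap.toSpanSingleton_apply]
    exact smul _ _ (ofPath a b p)

/-- Elements of degree `l` are combinations of paths of length `l`. -/
theorem induction_on_gradedPiece {l : ℕ} {motive : PathAlgebra Q → Prop} {x : PathAlgebra Q}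
    (hx : x ∈ gradedPiece Q l) (zero : motive 0)
    (add : ∀ x y, motive x → motive y → motive (x + y))
    (smul : ∀ (r : ℝ) (x), motive x → motive (r • x))
    (ofPath : ∀ (a b : Q) (p : Quiver.Path a b), p.length = l → motive (ofPath p)) : motive x := by
  classical
  rw [← sum_component x]
  refine Finset.sum_induction _ motive add zero fun a _ => ?_
  refine Finset.sum_induction _ motive add zero fun b _ => ?_
  rw [component, Finsupp.lsum_apply, Finsupp.sum]
  refine Finset.sum_induction _ motive add zero fun p hp => ?_
  exact smul _ _ (ofPath a b p (hx a b p (Finsupp.mem_support_iff.1 hp)))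

/-- A linear map out of the path algebra is given by its values on paths. -/
def liftLinear {B : Type*} [Ring B] [Algebra ℝ B] (M : ∀ a b : Q, Quiver.Path a b → B) :
    PathAlgebra Q →ₗ[ℝ] B where
  toFun x := ∑ a, ∑ b, Finsupp.lsum ℝ (fun p => LinearMap.toSpanSingleton ℝ B (M a b p)) (x a b)
  map_add' x y := by simp only [add_apply, map_add, Finset.sum_add_distrib]
  map_smul' r x := by
    have h : ∀ a b, (r • x) a b = r • x a b := fun _ _ => rfl
    simp only [h, map_smul, Finset.smul_sum, RingHom.id_apply]

theorem liftLinear_ofPath {B : Type*} [Ring B] [Algebra ℝ B]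
    (M : ∀ a b : Q, Quiver.Path a b → B) {a b : Q} (p : Quiver.Path a b) :
    liftLinear M (ofPath p) = M a b p := by
  change ∑ a', ∑ b', Finsupp.lsum ℝ (fun p => LinearMap.toSpanSingleton ℝ B (M a' b' p))
    (ofPath p a' b') = _
  rw [Finset.sum_eq_single a, Finset.sum_eq_single b, ofPath_apply_self]
  · simp
  · intro b' _ hb
    rw [ofPath_apply_ne_right p hb, map_zero]
  · simp
  · intro a' _ ha
    refine Finset.sum_eq_zero fun b' _ => ?_
    rw [ofPath_apply_ne_left p ha, map_zero]
  · simp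

/-- A multiplicative assignment of values to the paths extends to the path algebra. -/
def lift {B : Type*} [Ring B] [Algebra ℝ B] (M : ∀ a b : Q, Quiver.Path a b → B)
    (hone : ∑ a, M a a Quiver.Path.nil = 1)
    (hmul : ∀ (a b c : Q) (p : Quiver.Path a b) (q : Quiver.Path b c),
      M a b p * M b c q = M a c (p.comp q))
    (hne : ∀ (a b b' c : Q) (p : Quiver.Path a b) (q : Quiver.Path b' c), b ≠ b' →
      M a b p * M b' c q = 0) : PathAlgebra Q →ₐ[ℝ] B :=
  AlgHom.ofLinearMap (liftLinear M)
    (by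
      change liftLinear M (∑ a, e a) = 1
      rw [map_sum, ← hone]
      exact Finset.sum_congr rfl fun a _ => liftLinear_ofPath M _)
    (fun x y => by
      induction x using induction_on with
      | zero => simp
      | add x x' hx hx' => rw [add_mul, map_add, map_add, add_mul, hx, hx']
      | smul r x hx => rw [smul_mul_assoc, map_smul, map_smul, smul_mul_assoc, hx]
      | ofPath a b p =>
        induction y using induction_on with
        | zero => simp
        | add y y' hy hy' => rw [mul_add, map_add, map_add, mul_add, hy, hy']
        | smul r y hy => rw [mul_smul_comm, map_smul, map_smul, mul_smul_comm, hy]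
        | ofPath b' c q =>
          by_cases hb : b = b'
          · subst hb
            rw [ofPath_mul_ofPath, liftLinear_ofPath, liftLinear_ofPath, liftLinear_ofPath, hmul]
          · rw [ofPath_mul_ofPath_of_ne _ _ hb, liftLinear_ofPath, liftLinear_ofPath,
              hne _ _ _ _ _ _ hb, map_zero])

theorem lift_ofPath {B : Type*} [Ring B] [Algebra ℝ B] (M : ∀ a b : Q, Quiver.Path a b → B)
    (hone hmul hne) {a b : Q} (p : Quiver.Path a b) :
    lift M hone hmul hne (ofPath p) = M a b p :=
  liftLinear_ofPath M p

theorem e_mul_ofPath {a b : Q} (p : Quiver.Path a b) : e a * ofPath p = ofPath p := by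
  rw [e, ofPath_mul_ofPath, Quiver.Path.nil_comp]

theorem ofPath_mul_e {a b : Q} (p : Quiver.Path a b) : ofPath p * e b = ofPath p := by
  rw [e, ofPath_mul_ofPath, Quiver.Path.comp_nil]

theorem e_mul_e (a : Q) : e a * e a = e a := e_mul_ofPath _

theorem ofPath_cons {a b c : Q} (p : Quiver.Path a b) (f : b ⟶ c) :
    ofPath (p.cons f) = ofPath p * edge f := by
  rw [edge, ofPath_mul_ofPath]
  rfl

end PathAlgebra

namespace PolarizedArrangement

variable {I : Type*} [Fintype I]

/-! ### Taut paths in the algebra `A` -/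

namespace A

variable (𝒲 : PolarizedArrangement I)

theorem e_eq_zero {a : 𝒲.Vertex} (ha : a.1 ∉ 𝒲.P) : e 𝒲 a = 0 := by
  rw [e, mk, RingQuot.mkAlgHom_rel ℝ (RelA.A1 a ha), map_zero]

theorem p_mul_p_comm {a b c d : 𝒲.Vertex} (hne : [a, b, c, d].Nodup)
    (hab : SignVector.Adj a.1 b.1) (hbc : SignVector.Adj b.1 c.1)
    (hcd : SignVector.Adj c.1 d.1) (hda : SignVector.Adj d.1 a.1)
    (had : SignVector.Adj a.1 d.1) (hdc : SignVector.Adj d.1 c.1) :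
    p 𝒲 hab * p 𝒲 hbc = p 𝒲 had * p 𝒲 hdc := by
  have h := RingQuot.mkAlgHom_rel ℝ (RelA.A2 a b c d hne hab hbc hcd hda had hdc)
  simp only [p, mk, ← map_mul, Algebra.TensorProduct.tmul_mul_tmul, mul_one]
  exact h

theorem p_mul_p_self {a b : 𝒲.Vertex} {i : I} (hi : SignVector.AdjAt i a.1 b.1)
    (hab : SignVector.Adj a.1 b.1) (hba : SignVector.Adj b.1 a.1) :
    p 𝒲 hab * p 𝒲 hba = t 𝒲 i * e 𝒲 a := by
  have h := RingQuot.mkAlgHom_rel ℝ (RelA.A3 a b i hi hab hba)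
  simp only [p, t, e, mk, ← map_mul, Algebra.TensorProduct.tmul_mul_tmul, mul_one, one_mul]
  exact h

theorem e_mul_p {a b : 𝒲.Vertex} (h : SignVector.Adj a.1 b.1) :
    e 𝒲 a * p 𝒲 h = p 𝒲 h := by
  simp only [e, p, ← map_mul, Algebra.TensorProduct.tmul_mul_tmul, mul_one]
  rw [edgePath, PathAlgebra.edge, PathAlgebra.e_mul_ofPath]

theorem p_mul_e {a b : 𝒲.Vertex} (h : SignVector.Adj a.1 b.1) :
    p 𝒲 h * e 𝒲 b = p 𝒲 h := by
  simp only [e, p, ← map_mul, Algebra.TensorProduct.tmul_mul_tmul, mul_one]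
  rw [edgePath, PathAlgebra.edge, PathAlgebra.ofPath_mul_e]

theorem e_mul_e (a : 𝒲.Vertex) : e 𝒲 a * e 𝒲 a = e 𝒲 a := by
  simp only [e, ← map_mul, Algebra.TensorProduct.tmul_mul_tmul, mul_one]
  rw [PathAlgebra.e_mul_e]

/-- The homomorphism from the polynomial ring to `Sym V^*` that sends `u_i` to `t_i`. -/
def polyToSym : MvPolynomial I ℝ →ₐ[ℝ] SymmetricAlgebra ℝ (Module.Dual ℝ 𝒲.V) :=
  MvPolynomial.aeval fun i => SymmetricAlgebra.ι ℝ _ (𝒲.coord i)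

/-- The central homomorphism from the polynomial ring to `A` that sends `u_i` to `t_i`. -/
def polyHom : MvPolynomial I ℝ →ₐ[ℝ] 𝒲.A :=
  (mk 𝒲).comp (Algebra.TensorProduct.includeRight.comp (polyToSym 𝒲))

theorem polyHom_apply (f : MvPolynomial I ℝ) : polyHom 𝒲 f = mk 𝒲 (1 ⊗ₜ polyToSym 𝒲 f) := rfl

@[simp] theorem polyHom_X (i : I) : polyHom 𝒲 (MvPolynomial.X i) = t 𝒲 i := by
  rw [polyHom_apply, polyToSym, MvPolynomial.aeval_X]
  rfl

theorem polyHom_comm (f : MvPolynomial I ℝ) (x : 𝒲.A) : polyHom 𝒲 f * x = x * polyHom 𝒲 f := by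
  obtain ⟨y, rfl⟩ := RingQuot.mkAlgHom_surjective ℝ 𝒲.RelA x
  change mk 𝒲 _ * mk 𝒲 y = mk 𝒲 y * mk 𝒲 _
  rw [← map_mul, ← map_mul]
  congr 1
  induction y using TensorProduct.induction_on with
  | zero => simp
  | add y y' hy hy' => rw [mul_add, add_mul, hy, hy']
  | tmul y s =>
    change (1 ⊗ₜ polyToSym 𝒲 f) * (y ⊗ₜ[ℝ] s) = (y ⊗ₜ[ℝ] s) * (1 ⊗ₜ polyToSym 𝒲 f)
    rw [Algebra.TensorProduct.tmul_mul_tmul, Algebra.TensorProduct.tmul_mul_tmul, mul_comm s,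
      one_mul, mul_one]

theorem sum_smul_coord (x : I → ℝ) : ∑ i, x i • 𝒲.coord i = dotRestrict 𝒲.V x := by
  ext v
  simp [coord, dotRestrict_apply, LinearMap.sum_apply]

theorem polyToSym_surjective : Function.Surjective (polyToSym 𝒲) := by
  intro s
  induction s using SymmetricAlgebra.induction with
  | algebraMap r => exact ⟨algebraMap _ _ r, AlgHom.commutes _ _⟩
  | ι f =>
    obtain ⟨x, rfl⟩ := dotRestrict_surjective 𝒲.V f
    refine ⟨∑ i, x i • MvPolynomial.X i, ?_⟩
    simp [polyToSym, ← sum_smul_coord]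
  | mul a b ha hb =>
    obtain ⟨f, rfl⟩ := ha
    obtain ⟨g, rfl⟩ := hb
    exact ⟨f * g, map_mul _ _ _⟩
  | add a b ha hb =>
    obtain ⟨f, rfl⟩ := ha
    obtain ⟨g, rfl⟩ := hb
    exact ⟨f + g, map_add _ _ _⟩

/-- `IsTaut 𝒲 a c x` says that `x` is the class in `A` of a path from `a` to `c` that crosses each
hyperplane at most once. -/
inductive IsTaut : 𝒲.Vertex → 𝒲.Vertex → 𝒲.A → Prop
  | nil (a : 𝒲.Vertex) : IsTaut a a (e 𝒲 a)
  | cons {a b c : 𝒲.Vertex} {x : 𝒲.A} (i : I) (hi : SignVector.AdjAt i a.1 b.1)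
      (h : SignVector.Adj a.1 b.1) (hic : a.1 i ≠ c.1 i) (hx : IsTaut b c x) :
      IsTaut a c (p 𝒲 h * x)

theorem exists_isTaut (a c : 𝒲.Vertex) : ∃ x, IsTaut 𝒲 a c x := by
  induction hn : SignVector.dist a.1 c.1 generalizing a with
  | zero =>
    obtain rfl : a = c := Subtype.ext (SignVector.dist_eq_zero hn)
    exact ⟨_, .nil a⟩
  | succ n ih =>
    obtain ⟨i, hic, hi⟩ := exists_flip_feasible a.2 c.2 (fun h => by
      rw [h, SignVector.dist_self] at hn
      exact absurd hn (Nat.succ_ne_zero n).symm)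
    obtain ⟨x, hx⟩ := ih ⟨_, hi⟩ (by
      have := SignVector.dist_flip hic
      exact Nat.succ_injective (this.trans hn))
    exact ⟨_, .cons i (SignVector.adjAt_flip i _) ⟨i, SignVector.adjAt_flip i _⟩ hic hx⟩

/-- The class in `A` of a chosen taut path from `a` to `c`. -/
def taut (a c : 𝒲.Vertex) : 𝒲.A := (exists_isTaut 𝒲 a c).choose

theorem isTaut_taut (a c : 𝒲.Vertex) : IsTaut 𝒲 a c (taut 𝒲 a c) :=
  (exists_isTaut 𝒲 a c).choose_spec

variable {𝒲}

/-- All taut paths between two vertices have the same class in `A`: the possible first steps of a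
taut path are connected through squares. -/
theorem IsTaut.eq_taut {a c : 𝒲.Vertex} {x : 𝒲.A} (hx : IsTaut 𝒲 a c x) : x = taut 𝒲 a c := by
  classical
  suffices h : ∀ (n : ℕ) (a c : 𝒲.Vertex), SignVector.dist a.1 c.1 = n →
      ∀ x y, IsTaut 𝒲 a c x → IsTaut 𝒲 a c y → x = y from
    h _ a c rfl _ _ hx (isTaut_taut 𝒲 a c)
  intro n
  induction n with
  | zero =>
    intro a c hn x y hx hy
    obtain rfl : a = c := Subtype.ext (SignVector.dist_eq_zero hn)
    cases hx with
    | nil =>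
      cases hy with
      | nil => rfl
      | cons i hi h hic => exact absurd rfl hic
    | cons i hi h hic => exact absurd rfl hic
  | succ n ih =>
    intro a c hn
    -- `Q i` is the class of the taut paths that cross the hyperplane `i` first; by induction it does
    -- not depend on the rest of the path.
    set Q : I → 𝒲.A := fun i =>
      if h : SignVector.flip i a.1 ∈ 𝒲.feasible then
        p 𝒲 (a := a) (b := ⟨_, h⟩) ⟨i, SignVector.adjAt_flip i a.1⟩ * taut 𝒲 ⟨_, h⟩ c
      else 0 with hQ
    have hQx : ∀ x, IsTaut 𝒲 a c x →
        ∃ i, a.1 i ≠ c.1 i ∧ SignVector.flip i a.1 ∈ 𝒲.feasible ∧ x = Q i := by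
      intro x hx
      cases hx with
      | nil => simp at hn
      | @cons _ b _ x i hi h hic hx =>
        obtain ⟨b, hb⟩ := b
        obtain rfl : b = _ := hi.eq_flip
        refine ⟨i, hic, hb, ?_⟩
        rw [hQ]
        dsimp only
        rw [dif_pos hb, ih _ c (Nat.succ_injective ((SignVector.dist_flip hic).trans hn)) _ _ hx
          (isTaut_taut 𝒲 _ c)]
    intro x y hx hy
    obtain ⟨i, hic, hi, rfl⟩ := hQx x hx
    obtain ⟨j, hjc, hj, rfl⟩ := hQx y hy
    refine eq_of_flip_feasible a.2 c.2 Q ?_ hic hjc hi hj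
    intro i j hij hic hjc hi hj hji
    set b : 𝒲.Vertex := ⟨_, hi⟩ with hb
    set d : 𝒲.Vertex := ⟨_, hj⟩ with hd
    set m : 𝒲.Vertex := ⟨_, hji⟩ with hm
    have hab : SignVector.AdjAt i a.1 b.1 := SignVector.adjAt_flip i _
    have had : SignVector.AdjAt j a.1 d.1 := SignVector.adjAt_flip j _
    have hbm : SignVector.AdjAt j b.1 m.1 := SignVector.adjAt_flip j _
    have hdm : SignVector.AdjAt i d.1 m.1 := by
      rw [hm, hd]
      dsimp only
      rw [SignVector.flip_comm]
      exact SignVector.adjAt_flip i _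
    have hbj : b.1 j ≠ c.1 j := by
      rw [hb]
      dsimp only
      rwa [SignVector.flip_of_ne hij.symm]
    have hdi : d.1 i ≠ c.1 i := by
      rw [hd]
      dsimp only
      rwa [SignVector.flip_of_ne hij]
    have h1 : taut 𝒲 b c = p 𝒲 ⟨j, hbm⟩ * taut 𝒲 m c :=
      ih b c (Nat.succ_injective ((SignVector.dist_flip hic).trans hn)) _ _ (isTaut_taut 𝒲 b c)
        (.cons j hbm _ hbj (isTaut_taut 𝒲 m c))
    have h2 : taut 𝒲 d c = p 𝒲 ⟨i, hdm⟩ * taut 𝒲 m c :=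
      ih d c (Nat.succ_injective ((SignVector.dist_flip hjc).trans hn)) _ _ (isTaut_taut 𝒲 d c)
        (.cons i hdm _ hdi (isTaut_taut 𝒲 m c))
    have hne : [a, b, m, d].Nodup := by
      have hv : ∀ {x y : 𝒲.Vertex} (k : I), x.1 k ≠ y.1 k → x ≠ y := fun k hk h => hk (h ▸ rfl)
      have e1 : a ≠ b := hv i ((hab i).2 rfl)
      have e2 : a ≠ d := hv j ((had j).2 rfl)
      have e3 : b ≠ m := hv j ((hbm j).2 rfl)
      have e4 : m ≠ d := (hv i ((hdm i).2 rfl)).symm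
      have e5 : b ≠ d := hv i (by
        rw [← not_ne_iff.1 (mt (had i).1 hij)]
        exact ((hab i).2 rfl).symm)
      have e6 : a ≠ m := hv i (by
        rw [← not_ne_iff.1 (mt (hbm i).1 hij)]
        exact (hab i).2 rfl)
      simp [e1, e2, e3, e4, e5, e6]
    simp only [hQ]
    rw [dif_pos hi, dif_pos hj]
    change p 𝒲 _ * taut 𝒲 b c = p 𝒲 _ * taut 𝒲 d c
    rw [h1, h2, ← mul_assoc, ← mul_assoc,
      p_mul_p_comm 𝒲 hne ⟨i, hab⟩ ⟨j, hbm⟩ ⟨i, hdm.symm⟩ ⟨j, had.symm⟩ ⟨j, had⟩ ⟨i, hdm⟩]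

theorem taut_self (a : 𝒲.Vertex) : taut 𝒲 a a = e 𝒲 a := (IsTaut.nil a).eq_taut.symm

theorem e_mul_taut (a c : 𝒲.Vertex) : e 𝒲 a * taut 𝒲 a c = taut 𝒲 a c := by
  have h := isTaut_taut 𝒲 a c
  generalize taut 𝒲 a c = x at h
  cases h with
  | nil => exact e_mul_e 𝒲 a
  | cons i hi h hic hx => rw [← mul_assoc, e_mul_p]

theorem taut_mul_e (a c : 𝒲.Vertex) : taut 𝒲 a c * e 𝒲 c = taut 𝒲 a c := by
  have h := isTaut_taut 𝒲 a c
  generalize taut 𝒲 a c = x at h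
  induction h with
  | nil => exact e_mul_e 𝒲 _
  | cons i hi h hic hx ih => rw [mul_assoc, ih]

theorem taut_of_adj {a b : 𝒲.Vertex} (h : SignVector.Adj a.1 b.1) : taut 𝒲 a b = p 𝒲 h := by
  obtain ⟨i, hi⟩ := id h
  rw [← p_mul_e]
  exact (IsTaut.cons i hi h ((hi i).2 rfl) (.nil b)).eq_taut.symm

/-- A single step followed by a taut path is either taut, or it undoes the first step of a taut path
and thus contributes a factor `t_i`. -/
theorem p_mul_taut {a b : 𝒲.Vertex} (c : 𝒲.Vertex) (h : SignVector.Adj a.1 b.1) :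
    p 𝒲 h * taut 𝒲 b c = polyHom 𝒲 (u (SignVector.S a.1 b.1 c.1)) * taut 𝒲 a c := by
  obtain ⟨i, hi⟩ := id h
  by_cases hic : a.1 i = c.1 i
  · have hba : SignVector.Adj b.1 a.1 := ⟨i, hi.symm⟩
    have h1 : taut 𝒲 b c = p 𝒲 hba * taut 𝒲 a c :=
      (IsTaut.cons i hi.symm hba (hic ▸ ((hi i).2 rfl).symm) (isTaut_taut 𝒲 a c)).eq_taut.symm
    rw [h1, ← mul_assoc, p_mul_p_self 𝒲 hi, mul_assoc, e_mul_taut, hi.S_eq_singleton hic, u,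
      Finset.prod_singleton, polyHom_X]
  · rw [hi.S_eq_empty hic, u, Finset.prod_empty, map_one, one_mul]
    exact (IsTaut.cons i hi h hic (isTaut_taut 𝒲 b c)).eq_taut

/-- The classes of taut paths multiply like the elements `1_{αβ}` of `B`. -/
theorem taut_mul_taut (a b c : 𝒲.Vertex) :
    taut 𝒲 a b * taut 𝒲 b c = polyHom 𝒲 (u (SignVector.S a.1 b.1 c.1)) * taut 𝒲 a c := by
  have h := isTaut_taut 𝒲 a b
  generalize taut 𝒲 a b = x at h
  induction h with
  | nil a =>
    have hS : SignVector.S a.1 a.1 c.1 = ∅ := SignVector.S_eq_empty fun i hi => absurd rfl hi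
    rw [e_mul_taut, hS, u, Finset.prod_empty, map_one, one_mul]
  | @cons a a' b x i hi h hib hx ih =>
    have h1 := u_mul_u a.1 a'.1 b.1 c.1
    rw [hi.S_eq_empty hib, u, Finset.prod_empty, one_mul] at h1
    rw [mul_assoc, ih, ← mul_assoc, ← polyHom_comm, mul_assoc, p_mul_taut, ← mul_assoc, ← map_mul,
      h1]

variable (𝒲) in
/-- A taut path between `a` and `c` has length `d_{ac}`. -/
theorem exists_taut_eq_mk (a c : 𝒲.Vertex) :
    ∃ x ∈ PathAlgebra.gradedPiece 𝒲.Vertex (SignVector.dist a.1 c.1), taut 𝒲 a c = mk 𝒲 (x ⊗ₜ 1) := by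
  suffices h : ∀ x, IsTaut 𝒲 a c x → ∃ q : Quiver.Path a c,
      q.length = SignVector.dist a.1 c.1 ∧ x = mk 𝒲 (PathAlgebra.ofPath q ⊗ₜ 1) by
    obtain ⟨q, hq, hx⟩ := h _ (isTaut_taut 𝒲 a c)
    exact ⟨_, hq ▸ PathAlgebra.ofPath_mem_gradedPiece q, hx⟩
  intro x hx
  induction hx with
  | nil a => exact ⟨.nil, by simp, rfl⟩
  | @cons a b c x i hi h hic hx ih =>
    obtain ⟨q, hq, rfl⟩ := ih
    refine ⟨(Quiver.Hom.toPath (PLift.up h : a ⟶ b)).comp q, ?_, ?_⟩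
    · rw [Quiver.Path.length_comp, hq, ← SignVector.dist_flip hic, ← hi.eq_flip]
      simp [add_comm]
    · rw [← PathAlgebra.ofPath_mul_ofPath, p, ← map_mul, Algebra.TensorProduct.tmul_mul_tmul,
        mul_one]
      rfl

/-- The class of every path is a monomial times the class of a taut path. -/
theorem exists_mk_ofPath_eq {a b : 𝒲.Vertex} (q : Quiver.Path a b) :
    ∃ f, mk 𝒲 (PathAlgebra.ofPath q ⊗ₜ 1) = polyHom 𝒲 f * taut 𝒲 a b := by
  induction q with
  | nil => exact ⟨1, by rw [map_one, one_mul, taut_self]; rfl⟩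
  | @cons b c q h ih =>
    obtain ⟨f, hf⟩ := ih
    refine ⟨f * u (SignVector.S a.1 b.1 c.1), ?_⟩
    have h1 : mk 𝒲 (PathAlgebra.edge h ⊗ₜ 1) = p 𝒲 h.down := rfl
    have h2 : (PathAlgebra.ofPath (q.cons h) ⊗ₜ 1 : 𝒲.PreA) =
        (PathAlgebra.ofPath q ⊗ₜ 1) * (PathAlgebra.edge h ⊗ₜ 1) := by
      rw [PathAlgebra.ofPath_cons, Algebra.TensorProduct.tmul_mul_tmul, mul_one]
    rw [h2, map_mul, hf, h1, ← taut_of_adj, mul_assoc, taut_mul_taut, map_mul, mul_assoc]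

/-- The algebra `A` is spanned by the multiples of the classes of taut paths. -/
theorem eq_top_of_polyHom_mul_taut_mem (M : Submodule ℝ 𝒲.A)
    (h : ∀ (f : MvPolynomial I ℝ) (a b : 𝒲.Vertex), polyHom 𝒲 f * taut 𝒲 a b ∈ M) : M = ⊤ := by
  refine Submodule.eq_top_iff'.2 fun x => ?_
  obtain ⟨y, rfl⟩ := RingQuot.mkAlgHom_surjective ℝ 𝒲.RelA x
  change mk 𝒲 y ∈ M
  induction y using TensorProduct.induction_on with
  | zero => simp
  | add y y' hy hy' => rw [map_add]; exact add_mem hy hy'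
  | tmul y s =>
    obtain ⟨f, rfl⟩ := polyToSym_surjective 𝒲 s
    induction y using PathAlgebra.induction_on with
    | zero => simp
    | add y y' hy hy' => rw [TensorProduct.add_tmul, map_add]; exact add_mem hy hy'
    | smul r y hy => rw [← TensorProduct.smul_tmul', map_smul]; exact M.smul_mem r hy
    | ofPath a b q =>
      obtain ⟨g, hg⟩ := exists_mk_ofPath_eq q
      have h1 : (PathAlgebra.ofPath q ⊗ₜ polyToSym 𝒲 f : 𝒲.PreA) =
          (1 ⊗ₜ polyToSym 𝒲 f) * (PathAlgebra.ofPath q ⊗ₜ 1) := by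
        rw [Algebra.TensorProduct.tmul_mul_tmul, one_mul, mul_one]
      rw [h1, map_mul, hg, ← polyHom_apply, ← mul_assoc, ← map_mul]
      exact h _ _ _

end A

end PolarizedArrangement

namespace PolarizedArrangement

variable {I : Type*} [Fintype I]

/-! ### Units and central elements of the algebra `B` -/

theorem star_one_one (𝒱 : PolarizedArrangement I) (α β γ : SignVector I) :
    𝒱.star α β γ 1 1 = 𝒱.mkR _ (u (SignVector.S α β γ)) := by
  rw [← map_one (𝒱.mkR _), ← map_one (𝒱.mkR _), star_mk, mul_one, mul_one]

section Descent

variable (𝒱 : PolarizedArrangement I) (D : Set (I → ℝ)) {M : Type*} [AddCommMonoid M] [Module ℝ M]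
  (g : MvPolynomial I ℝ →ₗ[ℝ] M)

theorem apply_surjInv_mkR (hg : ∀ f ∈ 𝒱.idealR D, g f = 0) (f : MvPolynomial I ℝ) :
    g (Function.surjInv (𝒱.mkR_surjective D) (𝒱.mkR D f)) = g f := by
  set f' := Function.surjInv (𝒱.mkR_surjective D) (𝒱.mkR D f) with hf'
  have h1 : f' - f ∈ 𝒱.idealR D := by
    rw [← mkR_eq_zero, map_sub, hf', Function.surjInv_eq (𝒱.mkR_surjective D), sub_self]
  rw [← add_sub_cancel f f', map_add, hg _ h1, add_zero]

/-- A linear map on polynomials that kills the defining ideal of `R_D` descends to `R_D`. It is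
defined through a section of the quotient map, so that `M` need only be an additive monoid. -/
def liftR (hg : ∀ f ∈ 𝒱.idealR D, g f = 0) : 𝒱.R D →ₗ[ℝ] M where
  toFun x := g (Function.surjInv (𝒱.mkR_surjective D) x)
  map_add' x y := by
    obtain ⟨f, rfl⟩ := 𝒱.mkR_surjective D x
    obtain ⟨f', rfl⟩ := 𝒱.mkR_surjective D y
    rw [← map_add, apply_surjInv_mkR 𝒱 D g hg, apply_surjInv_mkR 𝒱 D g hg,
      apply_surjInv_mkR 𝒱 D g hg, map_add]
  map_smul' r x := by
    obtain ⟨f, rfl⟩ := 𝒱.mkR_surjective D x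
    rw [← map_smul, apply_surjInv_mkR 𝒱 D g hg, apply_surjInv_mkR 𝒱 D g hg, map_smul,
      RingHom.id_apply]

theorem liftR_mkR (hg : ∀ f ∈ 𝒱.idealR D, g f = 0) (f : MvPolynomial I ℝ) :
    liftR 𝒱 D g hg (𝒱.mkR D f) = g f :=
  apply_surjInv_mkR 𝒱 D g hg f

end Descent

namespace B

variable {𝒱 : PolarizedArrangement I}

theorem sum_apply {ι : Type*} (s : Finset ι) (f : ι → 𝒱.B) (a b : 𝒱.P) :
    (∑ i ∈ s, f i) a b = ∑ i ∈ s, f i a b := by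
  change (LinearMap.proj b ∘ₗ LinearMap.proj a :
    ((a b : 𝒱.P) → 𝒱.R (𝒱.Δ₂ a b)) →ₗ[ℝ] _) (∑ i ∈ s, f i : 𝒱.B) = _
  exact map_sum (LinearMap.proj b ∘ₗ LinearMap.proj a :
    ((a b : 𝒱.P) → 𝒱.R (𝒱.Δ₂ a b)) →ₗ[ℝ] _) f s

variable (𝒱) in
/-- The element of `B` with a prescribed `(a, b)`-component and no other component. -/
def single (a b : 𝒱.P) (x : 𝒱.R (𝒱.Δ₂ a b)) : 𝒱.B :=
  open Classical in Pi.single a (Pi.single b x)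

theorem single_apply_self (a b : 𝒱.P) (x : 𝒱.R (𝒱.Δ₂ a b)) : single 𝒱 a b x a b = x := by
  simp [single]

theorem single_apply_ne {a b a' b' : 𝒱.P} (x : 𝒱.R (𝒱.Δ₂ a b)) (h : a' ≠ a ∨ b' ≠ b) :
    single 𝒱 a b x a' b' = 0 := by
  classical
  by_cases ha : a' = a
  · subst ha
    simp [single, Pi.single_eq_of_ne (h.resolve_left fun h => h rfl)]
  · simp [single, Pi.single_eq_of_ne ha]

theorem unit_eq_single (a b : 𝒱.P) : unit 𝒱 a b = single 𝒱 a b 1 := rfl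

theorem sum_single (x : 𝒱.B) : ∑ a, ∑ b, single 𝒱 a b (x a b) = x := by
  classical
  funext a b
  rw [sum_apply, Finset.sum_eq_single a, sum_apply, Finset.sum_eq_single b, single_apply_self]
  · intro b' _ hb
    exact single_apply_ne _ (Or.inr hb.symm)
  · simp
  · intro a' _ ha
    rw [sum_apply]
    exact Finset.sum_eq_zero fun b' _ => single_apply_ne _ (Or.inl ha.symm)
  · simp

theorem single_mul_single (a b c : 𝒱.P) (x : 𝒱.R (𝒱.Δ₂ a b)) (y : 𝒱.R (𝒱.Δ₂ b c)) :
    single 𝒱 a b x * single 𝒱 b c y = single 𝒱 a c (𝒱.star a b c x y) := by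
  funext a' c'
  rw [mul_apply, Finset.sum_eq_single b]
  · by_cases ha : a' = a
    · subst ha
      by_cases hc : c' = c
      · subst hc
        simp [single_apply_self]
      · rw [single_apply_ne y (Or.inr hc), single_apply_ne _ (Or.inr hc), map_zero]
    · rw [single_apply_ne x (Or.inl ha), single_apply_ne _ (Or.inl ha), map_zero,
        LinearMap.zero_apply]
  · intro b' _ hb
    rw [single_apply_ne y (Or.inl hb), map_zero]
  · simp

theorem single_mul_single_of_ne {a b b' c : 𝒱.P} (h : b ≠ b') (x : 𝒱.R (𝒱.Δ₂ a b))
    (y : 𝒱.R (𝒱.Δ₂ b' c)) : single 𝒱 a b x * single 𝒱 b' c y = 0 := by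
  funext a' c'
  rw [mul_apply]
  refine Finset.sum_eq_zero fun d _ => ?_
  by_cases hd : d = b
  · subst hd
    rw [single_apply_ne y (Or.inl h), map_zero]
  · rw [single_apply_ne x (Or.inr hd), map_zero, LinearMap.zero_apply]

theorem ζ_apply_self (f : MvPolynomial I ℝ) (a : 𝒱.P) : ζ 𝒱 f a a = 𝒱.mkR _ f := if_pos rfl

theorem ζ_apply_ne (f : MvPolynomial I ℝ) {a b : 𝒱.P} (h : a ≠ b) : ζ 𝒱 f a b = 0 := if_neg h

theorem star_mkR_left (α β : SignVector I) (f g : MvPolynomial I ℝ) :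
    𝒱.star α α β (𝒱.mkR _ f) (𝒱.mkR _ g) = 𝒱.mkR _ (f * g) := by
  rw [star_mk, SignVector.S_eq_empty fun i hi => absurd rfl hi]
  simp [u]

theorem star_mkR_right (α β : SignVector I) (f g : MvPolynomial I ℝ) :
    𝒱.star α β β (𝒱.mkR _ f) (𝒱.mkR _ g) = 𝒱.mkR _ (f * g) := by
  rw [star_mk, SignVector.S_eq_empty fun i hi => rfl]
  simp [u]

theorem ζ_mul_apply (f : MvPolynomial I ℝ) (x : 𝒱.B) (a b : 𝒱.P) :
    (ζ 𝒱 f * x) a b = 𝒱.mkR _ f * x a b := by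
  rw [mul_apply, Finset.sum_eq_single a]
  · rw [ζ_apply_self]
    obtain ⟨g, hg⟩ := 𝒱.mkR_surjective _ (x a b)
    rw [← hg, star_mkR_left, map_mul]
  · intro c _ hc
    rw [ζ_apply_ne f hc.symm, map_zero, LinearMap.zero_apply]
  · simp

theorem mul_ζ_apply (f : MvPolynomial I ℝ) (x : 𝒱.B) (a b : 𝒱.P) :
    (x * ζ 𝒱 f) a b = 𝒱.mkR _ f * x a b := by
  rw [mul_apply, Finset.sum_eq_single b]
  · rw [ζ_apply_self]
    obtain ⟨g, hg⟩ := 𝒱.mkR_surjective _ (x a b)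
    rw [← hg, star_mkR_right, mul_comm, map_mul]
  · intro c _ hc
    rw [ζ_apply_ne f hc, map_zero]
  · simp

theorem ζ_comm (f : MvPolynomial I ℝ) (x : 𝒱.B) : ζ 𝒱 f * x = x * ζ 𝒱 f := by
  funext a b
  rw [ζ_mul_apply, mul_ζ_apply]

theorem ζ_mul_single (f : MvPolynomial I ℝ) (a b : 𝒱.P) (x : 𝒱.R (𝒱.Δ₂ a b)) :
    ζ 𝒱 f * single 𝒱 a b x = single 𝒱 a b (𝒱.mkR _ f * x) := by
  funext a' b'
  rw [ζ_mul_apply]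
  by_cases h : a' ≠ a ∨ b' ≠ b
  · rw [single_apply_ne _ h, single_apply_ne _ h, mul_zero]
  · push Not at h
    obtain ⟨rfl, rfl⟩ := h
    rw [single_apply_self, single_apply_self]

variable (𝒱) in
/-- The map `ζ` as a homomorphism of algebras. -/
def ζHom : MvPolynomial I ℝ →ₐ[ℝ] 𝒱.B :=
  AlgHom.ofLinearMap
    { toFun := ζ 𝒱
      map_add' := fun f g => by
        funext a b
        by_cases h : a = b
        · subst h
          rw [add_apply, ζ_apply_self, ζ_apply_self, ζ_apply_self, map_add]
        · rw [add_apply, ζ_apply_ne _ h, ζ_apply_ne _ h, ζ_apply_ne _ h, add_zero]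
      map_smul' := fun r f => by
        funext a b
        change ζ 𝒱 (r • f) a b = r • ζ 𝒱 f a b
        by_cases h : a = b
        · subst h
          rw [ζ_apply_self, ζ_apply_self, map_smul]
        · rw [ζ_apply_ne _ h, ζ_apply_ne _ h, smul_zero] }
    rfl
    (fun f g => by
      change ζ 𝒱 (f * g) = ζ 𝒱 f * ζ 𝒱 g
      funext a b
      rw [ζ_mul_apply]
      by_cases h : a = b
      · subst h
        rw [ζ_apply_self, ζ_apply_self, map_mul]
      · rw [ζ_apply_ne _ h, ζ_apply_ne _ h, mul_zero])

theorem ζHom_apply (f : MvPolynomial I ℝ) : ζHom 𝒱 f = ζ 𝒱 f := rfl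

theorem ζ_eq_zero {f : MvPolynomial I ℝ} (hf : f ∈ 𝒱.linearIdeal) : ζ 𝒱 f = 0 := by
  funext a b
  by_cases h : a = b
  · subst h
    rw [ζ_apply_self]
    exact (mkR_eq_zero _ _ _).2 (Ideal.mem_sup_right hf)
  · exact ζ_apply_ne _ h

open Classical in
variable (𝒱) in
/-- The unit `1_{αβ}` of `R_{αβ}` as an element of `B` if both `α` and `β` are bounded and feasible,
and zero otherwise. -/
def unitOrZero (α β : SignVector I) : 𝒱.B :=
  if h : α ∈ 𝒱.P ∧ β ∈ 𝒱.P then unit 𝒱 ⟨α, h.1⟩ ⟨β, h.2⟩ else 0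

theorem unitOrZero_of_mem {α β : SignVector I} (hα : α ∈ 𝒱.P) (hβ : β ∈ 𝒱.P) :
    unitOrZero 𝒱 α β = unit 𝒱 ⟨α, hα⟩ ⟨β, hβ⟩ := dif_pos ⟨hα, hβ⟩

theorem unitOrZero_of_notMem_left {α β : SignVector I} (hα : α ∉ 𝒱.P) :
    unitOrZero 𝒱 α β = 0 := dif_neg fun h => hα h.1

theorem unitOrZero_of_notMem_right {α β : SignVector I} (hβ : β ∉ 𝒱.P) :
    unitOrZero 𝒱 α β = 0 := dif_neg fun h => hβ h.2

theorem unitOrZero_mul_of_ne {α β β' γ : SignVector I} (h : β ≠ β') :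
    unitOrZero 𝒱 α β * unitOrZero 𝒱 β' γ = 0 := by
  by_cases h1 : α ∈ 𝒱.P ∧ β ∈ 𝒱.P
  · by_cases h2 : β' ∈ 𝒱.P ∧ γ ∈ 𝒱.P
    · rw [unitOrZero_of_mem h1.1 h1.2, unitOrZero_of_mem h2.1 h2.2]
      exact single_mul_single_of_ne (fun h' => h (congrArg Subtype.val h')) _ _
    · rw [unitOrZero, unitOrZero, dif_neg h2, mul_zero]
  · rw [unitOrZero, dif_neg h1, zero_mul]

/-- For a bounded `β`, the product of `1_{αβ}` and `1_{βγ}` is `u_{S(αβγ)}` times `1_{αγ}`. If `β`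
is infeasible, then both sides vanish. -/
theorem unitOrZero_mul_unitOrZero {α β γ : SignVector I} (hβ : β ∈ 𝒱.bounded) :
    unitOrZero 𝒱 α β * unitOrZero 𝒱 β γ =
      ζ 𝒱 (u (SignVector.S α β γ)) * unitOrZero 𝒱 α γ := by
  by_cases hα : α ∈ 𝒱.P
  swap
  · simp [unitOrZero_of_notMem_left hα]
  by_cases hγ : γ ∈ 𝒱.P
  swap
  · simp [unitOrZero_of_notMem_right hγ]
  by_cases hβP : β ∈ 𝒱.P
  · rw [unitOrZero_of_mem hα hβP, unitOrZero_of_mem hβP hγ, unitOrZero_of_mem hα hγ,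
      unit_eq_single, unit_eq_single, unit_eq_single, single_mul_single, ζ_mul_single, mul_one,
      star_one_one]
  · rw [unitOrZero_of_notMem_right hβP, zero_mul, unitOrZero_of_mem hα hγ, unit_eq_single,
      ζ_mul_single]
    have hzero : 𝒱.mkR (𝒱.Δ₂ α γ) (u (SignVector.S α β γ)) = 0 := by
      refine (mkR_eq_zero _ _ _).2 (Ideal.mem_sup_left (Ideal.subset_span ⟨_, ?_, rfl⟩))
      refine Set.eq_empty_of_forall_notMem ?_
      rintro x ⟨⟨-, hx0⟩, hxα, hxγ⟩
      exact hβP ⟨⟨x, 𝒱.mem_Δ_of_flat hxα hxγ hx0⟩, hβ⟩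
    rw [hzero, zero_mul]
    funext a b
    by_cases h : a ≠ ⟨α, hα⟩ ∨ b ≠ ⟨γ, hγ⟩
    · exact (single_apply_ne _ h).symm
    · push Not at h
      obtain ⟨rfl, rfl⟩ := h
      exact (single_apply_self _ _ _).symm

end B

/-! ### The homomorphism from `A(𝒱^∨)` to `B(𝒱)` -/

namespace GaleDuality

variable (𝒱 : PolarizedArrangement I)

theorem vertex_mem_bounded (a : 𝒱.galeDual.Vertex) : a.1 ∈ 𝒱.bounded := by
  rw [← galeDual_feasible]
  exact a.2

/-- The value of `φ` on a path: the product of the images of its arrows. -/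
def pathMap {a : 𝒱.galeDual.Vertex} : ∀ {b : 𝒱.galeDual.Vertex}, Quiver.Path a b → 𝒱.B
  | _, .nil => B.unitOrZero 𝒱 a.1 a.1
  | c, .cons (b := b) q _ => pathMap q * B.unitOrZero 𝒱 b.1 c.1

theorem unitOrZero_self_mul (a : 𝒱.galeDual.Vertex) (β : SignVector I) :
    B.unitOrZero 𝒱 a.1 a.1 * B.unitOrZero 𝒱 a.1 β = B.unitOrZero 𝒱 a.1 β := by
  rw [B.unitOrZero_mul_unitOrZero (vertex_mem_bounded 𝒱 a),
    SignVector.S_eq_empty fun i hi => absurd rfl hi, u, Finset.prod_empty]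
  exact one_mul _

theorem mul_unitOrZero_self (α : SignVector I) (a : 𝒱.galeDual.Vertex) :
    B.unitOrZero 𝒱 α a.1 * B.unitOrZero 𝒱 a.1 a.1 = B.unitOrZero 𝒱 α a.1 := by
  rw [B.unitOrZero_mul_unitOrZero (vertex_mem_bounded 𝒱 a),
    SignVector.S_eq_empty fun i hi => rfl, u, Finset.prod_empty]
  exact one_mul _

theorem unitOrZero_mul_pathMap {a b : 𝒱.galeDual.Vertex} (q : Quiver.Path a b) :
    B.unitOrZero 𝒱 a.1 a.1 * pathMap 𝒱 q = pathMap 𝒱 q := by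
  induction q with
  | nil => exact unitOrZero_self_mul 𝒱 a _
  | cons q f ih => rw [pathMap, ← mul_assoc, ih]

theorem pathMap_mul_unitOrZero {a b : 𝒱.galeDual.Vertex} (q : Quiver.Path a b) :
    pathMap 𝒱 q * B.unitOrZero 𝒱 b.1 b.1 = pathMap 𝒱 q := by
  cases q with
  | nil => exact unitOrZero_self_mul 𝒱 a _
  | cons q f => rw [pathMap, mul_assoc, mul_unitOrZero_self]

theorem pathMap_comp {a b c : 𝒱.galeDual.Vertex} (q : Quiver.Path a b) (r : Quiver.Path b c) :
    pathMap 𝒱 q * pathMap 𝒱 r = pathMap 𝒱 (q.comp r) := by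
  induction r with
  | nil => exact pathMap_mul_unitOrZero 𝒱 q
  | cons r f ih => rw [Quiver.Path.comp_cons, pathMap, pathMap, ← mul_assoc, ih]

theorem sum_unitOrZero : ∑ a : 𝒱.galeDual.Vertex, B.unitOrZero 𝒱 a.1 a.1 = 1 := by
  classical
  have hinj : ∀ a : 𝒱.P, a.1 ∈ 𝒱.galeDual.feasible := fun a => by
    rw [galeDual_feasible]
    exact a.2.2
  have h1 : ∑ a : 𝒱.P, B.unitOrZero 𝒱 a.1 a.1 =
      ∑ a : 𝒱.galeDual.Vertex, B.unitOrZero 𝒱 a.1 a.1 := by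
    refine Finset.sum_of_injOn (fun a => ⟨a.1, hinj a⟩) (fun a _ b _ h => ?_)
      (fun _ _ => Finset.mem_coe.2 (Finset.mem_univ _)) ?_
      (fun _ _ => rfl)
    · have h' : a.1 = b.1 := congrArg (fun c : 𝒱.galeDual.Vertex => c.1) h
      exact Subtype.ext h'
    · intro a _ ha
      refine B.unitOrZero_of_notMem_left fun haP => ha ?_
      exact ⟨⟨a.1, haP⟩, by simp, rfl⟩
  rw [← h1]
  funext a b
  rw [B.sum_apply]
  by_cases h : a = b
  · subst h
    rw [Finset.sum_eq_single a, B.unitOrZero_of_mem a.2 a.2, B.unit_eq_single,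
      B.single_apply_self, B.one_apply_self]
    · intro c _ hc
      rw [B.unitOrZero_of_mem c.2 c.2, B.unit_eq_single, B.single_apply_ne _ (Or.inl hc.symm)]
    · simp
  · rw [B.one_apply_ne h]
    refine Finset.sum_eq_zero fun c _ => ?_
    rw [B.unitOrZero_of_mem c.2 c.2, B.unit_eq_single, B.single_apply_ne]
    by_contra! h'
    exact h (h'.1.trans h'.2.symm)

/-- The homomorphism on the path algebra. -/
def pathHom : PathAlgebra 𝒱.galeDual.Vertex →ₐ[ℝ] 𝒱.B :=
  PathAlgebra.lift (fun _ _ q => pathMap 𝒱 q) (sum_unitOrZero 𝒱)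
    (fun _ _ _ q r => pathMap_comp 𝒱 q r)
    (fun a b b' c q r hb => by
      rw [← pathMap_mul_unitOrZero, ← unitOrZero_mul_pathMap 𝒱 r, mul_assoc,
        ← mul_assoc _ _ (pathMap 𝒱 r),
        B.unitOrZero_mul_of_ne (fun h => hb (Subtype.ext h)), zero_mul, mul_zero])

theorem pathHom_ofPath {a b : 𝒱.galeDual.Vertex} (q : Quiver.Path a b) :
    pathHom 𝒱 (PathAlgebra.ofPath q) = pathMap 𝒱 q :=
  PathAlgebra.lift_ofPath _ _ _ _ q

theorem pathHom_e (a : 𝒱.galeDual.Vertex) :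
    pathHom 𝒱 (PathAlgebra.e a) = B.unitOrZero 𝒱 a.1 a.1 := by
  rw [PathAlgebra.e, pathHom_ofPath, pathMap]

theorem pathHom_edgePath {a b : 𝒱.galeDual.Vertex} (h : SignVector.Adj a.1 b.1) :
    pathHom 𝒱 (𝒱.galeDual.edgePath h) = B.unitOrZero 𝒱 a.1 b.1 := by
  rw [edgePath, PathAlgebra.edge, pathHom_ofPath, Quiver.Hom.toPath, pathMap, pathMap,
    unitOrZero_self_mul]

/-- The linear form `∑ i, x i * u_i`. -/
def linearForm : (I → ℝ) →ₗ[ℝ] MvPolynomial I ℝ :=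
  ∑ i, (LinearMap.toSpanSingleton ℝ _ (MvPolynomial.X i)) ∘ₗ LinearMap.proj i

theorem linearForm_apply (x : I → ℝ) :
    linearForm x = ∑ i, MvPolynomial.C (x i) * MvPolynomial.X i := by
  simp [linearForm, LinearMap.sum_apply, MvPolynomial.smul_eq_C_mul]

theorem linearForm_single [DecidableEq I] (i : I) :
    linearForm (Pi.single i 1) = (MvPolynomial.X i : MvPolynomial I ℝ) := by
  simp only [linearForm, LinearMap.sum_apply, LinearMap.comp_apply, LinearMap.proj_apply,
    LinearMap.toSpanSingleton_apply]
  rw [Finset.sum_eq_single i] <;> simp +contextual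

/-- The identification of `(V^⊥)^*` with the linear forms in the `u_i` modulo those in `V`. -/
def dualToQuotient :
    Module.Dual ℝ (perp 𝒱.V) →ₗ[ℝ] (MvPolynomial I ℝ ⧸ 𝒱.linearIdeal) :=
  ((perp (perp 𝒱.V)).liftQ ((Ideal.Quotient.mkₐ ℝ 𝒱.linearIdeal).toLinearMap ∘ₗ linearForm)
    (by
      rw [perp_perp]
      intro v hv
      change Ideal.Quotient.mk _ (linearForm v) = 0
      rw [Ideal.Quotient.eq_zero_iff_mem, linearForm_apply]
      exact Ideal.subset_span ⟨v, hv, rfl⟩)) ∘ₗ (quotPerpEquiv (perp 𝒱.V)).symm.toLinearMap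

theorem dualToQuotient_dotRestrict (x : I → ℝ) :
    dualToQuotient 𝒱 (dotRestrict (perp 𝒱.V) x) = Ideal.Quotient.mk _ (linearForm x) := by
  have h : (quotPerpEquiv (perp 𝒱.V)).symm (dotRestrict (perp 𝒱.V) x) =
      (perp (perp 𝒱.V)).mkQ x := by
    rw [LinearEquiv.symm_apply_eq]
    rfl
  rw [dualToQuotient, LinearMap.comp_apply, LinearEquiv.coe_coe, h, Submodule.mkQ_apply,
    Submodule.liftQ_apply]
  rfl

/-- The map `dualToQuotient`, with its domain written as the dual of the subspace of the Gale
dual. -/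
def galeDualToQuotient :
    Module.Dual ℝ 𝒱.galeDual.V →ₗ[ℝ] (MvPolynomial I ℝ ⧸ 𝒱.linearIdeal) :=
  dualToQuotient 𝒱

theorem galeDualToQuotient_coord (i : I) :
    galeDualToQuotient 𝒱 (𝒱.galeDual.coord i) = Ideal.Quotient.mk _ (MvPolynomial.X i) := by
  classical
  have h : 𝒱.galeDual.coord i = dotRestrict 𝒱.galeDual.V (Pi.single i 1) := by
    rw [← A.sum_smul_coord]
    simp [Pi.single_apply]
  rw [← linearForm_single]
  exact (congrArg (dualToQuotient 𝒱) h).trans (dualToQuotient_dotRestrict 𝒱 _)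

/-- The homomorphism on `Sym (V^⊥)^*`. -/
def symHom : SymmetricAlgebra ℝ (Module.Dual ℝ 𝒱.galeDual.V) →ₐ[ℝ] 𝒱.B :=
  (Ideal.Quotient.liftₐ 𝒱.linearIdeal (B.ζHom 𝒱)
    fun f hf => (B.ζHom_apply f).trans (B.ζ_eq_zero hf)).comp (SymmetricAlgebra.lift (galeDualToQuotient 𝒱))

theorem symHom_polyToSym (f : MvPolynomial I ℝ) :
    symHom 𝒱 (A.polyToSym 𝒱.galeDual f) = B.ζ 𝒱 f := by
  have h : (symHom 𝒱).comp (A.polyToSym 𝒱.galeDual) = B.ζHom 𝒱 := by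
    ext i
    rw [AlgHom.comp_apply, A.polyToSym, MvPolynomial.aeval_X, symHom, AlgHom.comp_apply,
      SymmetricAlgebra.lift_ι_apply, galeDualToQuotient_coord]
    rfl
  exact DFunLike.congr_fun h f

/-- The homomorphism on `P(Q) ⊗ Sym (V^⊥)^*`. -/
def preHom : 𝒱.galeDual.PreA →ₐ[ℝ] 𝒱.B :=
  Algebra.TensorProduct.lift (pathHom 𝒱) (symHom 𝒱) fun x s => by
    obtain ⟨f, rfl⟩ := A.polyToSym_surjective 𝒱.galeDual s
    rw [symHom_polyToSym]
    exact (B.ζ_comm f _).symm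

theorem preHom_tmul (x : PathAlgebra 𝒱.galeDual.Vertex) (s) :
    preHom 𝒱 (x ⊗ₜ s) = pathHom 𝒱 x * symHom 𝒱 s :=
  Algebra.TensorProduct.lift_tmul _ _ _ _ _

/-- Two consecutive steps that do not return to the start cross two different hyperplanes. -/
theorem S_eq_empty_of_adj_adj {α β γ : SignVector I} (hαβ : SignVector.Adj α β)
    (hβγ : SignVector.Adj β γ) (hαγ : α ≠ γ) : SignVector.S α β γ = ∅ := by
  obtain ⟨i, hi⟩ := hαβ
  refine hi.S_eq_empty fun h => hαγ ?_
  obtain ⟨j, hj⟩ := hβγ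
  have hij : i = j := (hj i).1 fun h' => (hi i).2 rfl (h.trans h'.symm)
  subst hij
  funext k
  by_cases hk : k = i
  · rw [hk, h]
  · exact (not_ne_iff.1 (mt (hi k).1 hk)).trans (not_ne_iff.1 (mt (hj k).1 hk))

theorem preHom_rel {x y : 𝒱.galeDual.PreA} (h : 𝒱.galeDual.RelA x y) :
    preHom 𝒱 x = preHom 𝒱 y := by
  cases h with
  | A1 a ha =>
    rw [galeDual_P] at ha
    rw [preHom_tmul, pathHom_e, B.unitOrZero_of_notMem_left ha, zero_mul, map_zero]
  | A2 a b c d hne hab hbc hcd hda had hdc =>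
    have hac : a.1 ≠ c.1 := fun h => by
      have : a = c := Subtype.ext h
      simp [this] at hne
    rw [preHom_tmul, preHom_tmul, map_mul, map_mul, pathHom_edgePath, pathHom_edgePath,
      pathHom_edgePath, pathHom_edgePath, B.unitOrZero_mul_unitOrZero (vertex_mem_bounded 𝒱 b),
      B.unitOrZero_mul_unitOrZero (vertex_mem_bounded 𝒱 d), S_eq_empty_of_adj_adj hab hbc hac,
      S_eq_empty_of_adj_adj had hdc hac]
  | A3 a b i hi hab hba =>
    have h1 : SymmetricAlgebra.ι ℝ _ (𝒱.galeDual.coord i) =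
        A.polyToSym 𝒱.galeDual (MvPolynomial.X i) := by
      rw [A.polyToSym, MvPolynomial.aeval_X]
    rw [preHom_tmul, preHom_tmul, map_mul, pathHom_edgePath, pathHom_edgePath, pathHom_e,
      B.unitOrZero_mul_unitOrZero (vertex_mem_bounded 𝒱 b), hi.S_eq_singleton rfl, map_one, mul_one,
      h1, symHom_polyToSym, ← B.ζ_comm, u, Finset.prod_singleton]

/-- The homomorphism `φ : A(𝒱^∨) → B(𝒱)`. -/
def hom : 𝒱.galeDual.A →ₐ[ℝ] 𝒱.B :=
  RingQuot.liftAlgHom ℝ ⟨preHom 𝒱, fun _ _ h => preHom_rel 𝒱 h⟩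

theorem hom_mk (x : 𝒱.galeDual.PreA) : hom 𝒱 (A.mk 𝒱.galeDual x) = preHom 𝒱 x :=
  RingQuot.liftAlgHom_mkAlgHom_apply ℝ _ _ _

theorem hom_e (a : 𝒱.galeDual.Vertex) :
    hom 𝒱 (A.e 𝒱.galeDual a) = B.unitOrZero 𝒱 a.1 a.1 := by
  rw [A.e, hom_mk, preHom_tmul, pathHom_e, map_one, mul_one]

theorem hom_p {a b : 𝒱.galeDual.Vertex} (h : SignVector.Adj a.1 b.1) :
    hom 𝒱 (A.p 𝒱.galeDual h) = B.unitOrZero 𝒱 a.1 b.1 := by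
  rw [A.p, hom_mk, preHom_tmul, pathHom_edgePath, map_one, mul_one]

theorem hom_polyHom (f : MvPolynomial I ℝ) : hom 𝒱 (A.polyHom 𝒱.galeDual f) = B.ζ 𝒱 f := by
  rw [A.polyHom_apply, hom_mk, preHom_tmul, map_one, one_mul, symHom_polyToSym]

theorem hom_t (i : I) : hom 𝒱 (A.t 𝒱.galeDual i) = B.ζ 𝒱 (MvPolynomial.X i) := by
  rw [← A.polyHom_X, hom_polyHom]

theorem hom_taut (a b : 𝒱.galeDual.Vertex) :
    hom 𝒱 (A.taut 𝒱.galeDual a b) = B.unitOrZero 𝒱 a.1 b.1 := by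
  have h := A.isTaut_taut 𝒱.galeDual a b
  generalize A.taut 𝒱.galeDual a b = x at h
  induction h with
  | nil a => exact hom_e 𝒱 a
  | @cons a b c x i hi h hic hx ih =>
    rw [map_mul, hom_p, ih, B.unitOrZero_mul_unitOrZero (vertex_mem_bounded 𝒱 b),
      hi.S_eq_empty hic, u, Finset.prod_empty]
    exact one_mul _

/-! ### The inverse map -/

/-- A bounded feasible sign vector as a vertex of the quiver of the Gale dual. -/
def vertex (a : 𝒱.P) : 𝒱.galeDual.Vertex :=
  ⟨a.1, by rw [galeDual_feasible]; exact a.2.2⟩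

/-- The ideal that defines `R_{αβ}` annihilates the taut path from `α` to `β`. -/
theorem polyHom_mul_taut_eq_zero (a b : 𝒱.galeDual.Vertex) {f : MvPolynomial I ℝ}
    (hf : f ∈ 𝒱.idealR (𝒱.Δ₂ a.1 b.1)) :
    A.polyHom 𝒱.galeDual f * A.taut 𝒱.galeDual a b = 0 := by
  classical
  let J : Ideal (MvPolynomial I ℝ) :=
    { carrier := {f | A.polyHom 𝒱.galeDual f * A.taut 𝒱.galeDual a b = 0}
      add_mem' := fun {f g} (hf : _ = 0) (hg : _ = 0) => by
        change A.polyHom 𝒱.galeDual (f + g) * A.taut 𝒱.galeDual a b = 0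
        rw [map_add, add_mul, hf, hg, add_zero]
      zero_mem' := by
        change A.polyHom 𝒱.galeDual 0 * A.taut 𝒱.galeDual a b = 0
        rw [map_zero, zero_mul]
      smul_mem' := fun g f (hf : _ = 0) => by
        change A.polyHom 𝒱.galeDual (g * f) * A.taut 𝒱.galeDual a b = 0
        rw [map_mul, mul_assoc, hf, mul_zero] }
  suffices h : 𝒱.idealR (𝒱.Δ₂ a.1 b.1) ≤ J from h hf
  refine sup_le (Ideal.span_le.2 ?_) (Ideal.span_le.2 ?_)
  · rintro _ ⟨S, hS, rfl⟩
    change A.polyHom 𝒱.galeDual (u S) * A.taut 𝒱.galeDual a b = 0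
    -- A walk from `a` to `b` through an infeasible `δ` vanishes, and if `δ` differs from `a` only
    -- where `b` does or inside `S`, then the class of the walk divides `u_S` times the taut path.
    set T : Finset I := S ∪ Finset.univ.filter fun i => a.1 i ≠ b.1 i with hT
    obtain ⟨δ, hδ, hδF, hδT⟩ := 𝒱.exists_galeDual_feasible_not_feasible T a.2 (by
      refine Set.eq_empty_of_forall_notMem ?_
      rintro x ⟨⟨hx, hx0⟩, hxa⟩
      refine (Set.eq_empty_iff_forall_notMem.1 hS) x
        ⟨⟨hx, fun i hi => hx0 i (Finset.mem_union_left _ hi)⟩, hxa,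
          mem_Δ_of_eq_zero hxa fun i hi => hx0 i (Finset.mem_union_right _ (by simpa using hi))⟩)
    set d : 𝒱.galeDual.Vertex := ⟨δ, hδ⟩ with hd
    have hd0 : A.e 𝒱.galeDual d = 0 := A.e_eq_zero 𝒱.galeDual fun h => by
      rw [galeDual_P] at h
      exact hδF h.1
    have h1 := A.taut_mul_taut a d b
    rw [← A.taut_mul_e a d, hd0, mul_zero, zero_mul] at h1
    have hsub : SignVector.S a.1 d.1 b.1 ⊆ S := by
      intro i hi
      simp only [SignVector.S, Finset.mem_filter, Finset.mem_univ, true_and] at hi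
      have h2 := hδT i (hi.1.symm ▸ hi.2)
      rw [hT, Finset.mem_union] at h2
      exact h2.resolve_right (by simp [hi.1])
    rw [u, ← Finset.prod_sdiff hsub, map_mul, mul_assoc]
    change _ * (A.polyHom _ (u _) * _) = 0
    rw [← h1, mul_zero]
  · rintro _ ⟨v, hv, rfl⟩
    change A.polyHom 𝒱.galeDual (∑ i, MvPolynomial.C (v i) * MvPolynomial.X i) *
      A.taut 𝒱.galeDual a b = 0
    have h1 : A.polyToSym 𝒱.galeDual (∑ i, MvPolynomial.C (v i) * MvPolynomial.X i) =
        SymmetricAlgebra.ι ℝ _ (∑ i, v i • 𝒱.galeDual.coord i) := by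
      simp [A.polyToSym, ← MvPolynomial.smul_eq_C_mul]
    have h2 : dotRestrict 𝒱.galeDual.V v = 0 := le_perp_perp 𝒱.V hv
    rw [A.polyHom_apply, h1, A.sum_smul_coord, h2, map_zero, TensorProduct.tmul_zero, map_zero,
      zero_mul]

/-- The linear map that sends `f` to `f` times the taut path from `a` to `b`. -/
def mulTaut (a b : 𝒱.galeDual.Vertex) : MvPolynomial I ℝ →ₗ[ℝ] 𝒱.galeDual.A :=
  LinearMap.mulRight ℝ (A.taut 𝒱.galeDual a b) ∘ₗ (A.polyHom 𝒱.galeDual).toLinearMap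

/-- The inverse of `φ` on `R_{αβ}`: the class of a polynomial `f` goes to `f` times the taut path
from `α` to `β`. -/
def invComponent (a b : 𝒱.P) : 𝒱.R (𝒱.Δ₂ a b) →ₗ[ℝ] 𝒱.galeDual.A :=
  liftR 𝒱 (𝒱.Δ₂ a b) (mulTaut 𝒱 (vertex 𝒱 a) (vertex 𝒱 b))
    fun _ hf => polyHom_mul_taut_eq_zero 𝒱 (vertex 𝒱 a) (vertex 𝒱 b) hf

theorem invComponent_mkR (a b : 𝒱.P) (f : MvPolynomial I ℝ) :
    invComponent 𝒱 a b (𝒱.mkR _ f) =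
      A.polyHom 𝒱.galeDual f * A.taut 𝒱.galeDual (vertex 𝒱 a) (vertex 𝒱 b) :=
  liftR_mkR 𝒱 _ _ _ f

/-- The inverse of `φ`, as a linear map. -/
def inv : 𝒱.B →ₗ[ℝ] 𝒱.galeDual.A where
  toFun x := ∑ a, ∑ b, invComponent 𝒱 a b (x a b)
  map_add' x y := by simp only [B.add_apply, map_add, Finset.sum_add_distrib]
  map_smul' r x := by
    have h : ∀ a b, (r • x) a b = r • x a b := fun _ _ => rfl
    simp only [h, map_smul, Finset.smul_sum, RingHom.id_apply]

theorem hom_invComponent (a b : 𝒱.P) (x : 𝒱.R (𝒱.Δ₂ a b)) :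
    hom 𝒱 (invComponent 𝒱 a b x) = B.single 𝒱 a b x := by
  obtain ⟨f, rfl⟩ := 𝒱.mkR_surjective _ x
  have h : B.unitOrZero 𝒱 (vertex 𝒱 a).1 (vertex 𝒱 b).1 = B.single 𝒱 a b 1 :=
    B.unitOrZero_of_mem a.2 b.2
  rw [invComponent_mkR, map_mul, hom_polyHom, hom_taut, h, B.ζ_mul_single, mul_one]

theorem hom_inv (x : 𝒱.B) : hom 𝒱 (inv 𝒱 x) = x := by
  change hom 𝒱 (∑ a, ∑ b, invComponent 𝒱 a b (x a b)) = x
  simp only [map_sum, hom_invComponent]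
  exact B.sum_single x

theorem inv_single (a b : 𝒱.P) (x : 𝒱.R (𝒱.Δ₂ a b)) :
    inv 𝒱 (B.single 𝒱 a b x) = invComponent 𝒱 a b x := by
  change ∑ a', ∑ b', invComponent 𝒱 a' b' (B.single 𝒱 a b x a' b') = _
  rw [Finset.sum_eq_single a, Finset.sum_eq_single b, B.single_apply_self]
  · intro b' _ hb
    rw [B.single_apply_ne x (Or.inr hb), map_zero]
  · simp
  · intro a' _ ha
    refine Finset.sum_eq_zero fun b' _ => ?_
    rw [B.single_apply_ne x (Or.inl ha), map_zero]
  · simp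

theorem inv_surjective : Function.Surjective (inv 𝒱) := by
  rw [← LinearMap.range_eq_top]
  refine A.eq_top_of_polyHom_mul_taut_mem _ fun f a b => ?_
  have hP : ∀ c : 𝒱.galeDual.Vertex, c.1 ∉ 𝒱.P → A.e 𝒱.galeDual c = 0 := fun c hc =>
    A.e_eq_zero _ (by rwa [galeDual_P])
  by_cases ha : a.1 ∈ 𝒱.P
  · by_cases hb : b.1 ∈ 𝒱.P
    · exact ⟨B.single 𝒱 ⟨a.1, ha⟩ ⟨b.1, hb⟩ (𝒱.mkR _ f),
        (inv_single 𝒱 _ _ _).trans (invComponent_mkR 𝒱 _ _ f)⟩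
    · rw [← A.taut_mul_e, hP b hb, mul_zero, mul_zero]
      exact Submodule.zero_mem _
  · rw [← A.e_mul_taut, hP a ha, zero_mul, mul_zero]
    exact Submodule.zero_mem _

theorem hom_bijective : Function.Bijective (hom 𝒱) := by
  refine ⟨fun x y hxy => ?_, fun x => ⟨inv 𝒱 x, hom_inv 𝒱 x⟩⟩
  obtain ⟨x, rfl⟩ := inv_surjective 𝒱 x
  obtain ⟨y, rfl⟩ := inv_surjective 𝒱 y
  rw [hom_inv, hom_inv] at hxy
  rw [hxy]

/-- The isomorphism `φ : A(𝒱^∨) ≃ B(𝒱)`. -/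
def equiv : 𝒱.galeDual.A ≃ₐ[ℝ] 𝒱.B := AlgEquiv.ofBijective (hom 𝒱) (hom_bijective 𝒱)

end GaleDuality

end PolarizedArrangement

/-! ### Gradings -/

/-- A family of subspaces that spans an algebra, is compatible with the multiplication, and is cut
out by projections is a grading. -/
theorem nonempty_gradedAlgebra_of_proj {A : Type*} [Ring A] [Algebra ℝ A] (𝒜 : ℕ → Submodule ℝ A)
    (hone : 1 ∈ 𝒜 0) (hmul : ∀ m n x y, x ∈ 𝒜 m → y ∈ 𝒜 n → x * y ∈ 𝒜 (m + n))
    (pr : ℕ → A →ₗ[ℝ] A) (hsame : ∀ n, ∀ x ∈ 𝒜 n, pr n x = x)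
    (hne : ∀ m n, n ≠ m → ∀ x ∈ 𝒜 m, pr n x = 0) (htop : ⨆ n, 𝒜 n = ⊤) :
    Nonempty (GradedAlgebra 𝒜) := by
  have hind : iSupIndep 𝒜 := by
    intro n
    rw [Submodule.disjoint_def]
    intro x hx hx'
    have h1 : ⨆ m, ⨆ _ : m ≠ n, 𝒜 m ≤ LinearMap.ker (pr n) :=
      iSup_le fun m => iSup_le fun hm y hy => hne m n hm.symm y hy
    rw [← hsame n x hx]
    exact h1 hx'
  have hint : DirectSum.IsInternal 𝒜 :=
    DirectSum.isInternal_submodule_of_iSupIndep_of_iSup_eq_top hind htop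
  exact ⟨{ one_mem := hone
           mul_mem := fun {m n x y} hx hy => hmul m n x y hx hy
           toDecomposition := hint.chooseDecomposition }⟩

namespace PolarizedArrangement

variable {I : Type*} [Fintype I]

theorem isWeightedHomogeneous_u {I : Type*} (S : Finset I) :
    (u S).IsWeightedHomogeneous (fun _ : I => 2) (2 * S.card) := by
  have h := MvPolynomial.IsWeightedHomogeneous.prod (R := ℝ) S MvPolynomial.X (fun _ => 2)
    (w := fun _ : I => 2) fun i _ => MvPolynomial.isWeightedHomogeneous_X ℝ _ i
  rw [Finset.sum_const, smul_eq_mul, mul_comm] at h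
  exact h

theorem isHomogeneous_idealR (𝒱 : PolarizedArrangement I) (D : Set (I → ℝ))
    {f : MvPolynomial I ℝ} (hf : f ∈ 𝒱.idealR D) (n : ℕ) :
    MvPolynomial.weightedHomogeneousComponent (fun _ : I => 2) n f ∈ 𝒱.idealR D := by
  let := MvPolynomial.weightedGradedAlgebra ℝ (fun _ : I => 2)
  refine MvPolynomial.weightedHomogeneousComponent_mem_of_mem ℝ _ ?_ hf n
  refine Ideal.IsHomogeneous.sup (Ideal.homogeneous_span _ _ ?_) (Ideal.homogeneous_span _ _ ?_)
  · rintro _ ⟨S, -, rfl⟩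
    exact ⟨_, isWeightedHomogeneous_u S⟩
  · rintro _ ⟨v, -, rfl⟩
    exact ⟨2, Submodule.sum_mem _ fun i _ => (MvPolynomial.isWeightedHomogeneous_X ℝ _ i).C_mul _⟩

section ProjR

variable (𝒱 : PolarizedArrangement I) (D : Set (I → ℝ))

/-- The projection of `R_D` to its degree `n` part. -/
def projR (n : ℕ) : 𝒱.R D →ₗ[ℝ] 𝒱.R D :=
  liftR 𝒱 D ((𝒱.mkR D).toLinearMap ∘ₗ
    MvPolynomial.weightedHomogeneousComponent (fun _ : I => 2) n)
    fun _ hf => (mkR_eq_zero _ _ _).2 (isHomogeneous_idealR 𝒱 D hf n)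

theorem projR_mkR (n : ℕ) (f : MvPolynomial I ℝ) : projR 𝒱 D n (𝒱.mkR D f) =
    𝒱.mkR D (MvPolynomial.weightedHomogeneousComponent (fun _ : I => 2) n f) :=
  liftR_mkR 𝒱 D _ _ f

theorem projR_same {n : ℕ} {x : 𝒱.R D} (hx : x ∈ 𝒱.gradedPieceR D n) : projR 𝒱 D n x = x := by
  obtain ⟨f, hf, rfl⟩ := hx
  refine (projR_mkR 𝒱 D n f).trans ?_
  rw [MvPolynomial.IsWeightedHomogeneous.weightedHomogeneousComponent_same hf]
  rfl

theorem projR_ne {m n : ℕ} (h : n ≠ m) {x : 𝒱.R D} (hx : x ∈ 𝒱.gradedPieceR D m) :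
    projR 𝒱 D n x = 0 := by
  obtain ⟨f, hf, rfl⟩ := hx
  refine (projR_mkR 𝒱 D n f).trans ?_
  rw [MvPolynomial.IsWeightedHomogeneous.weightedHomogeneousComponent_ne n hf h, map_zero]

end ProjR

namespace B

variable {𝒱 : PolarizedArrangement I}

/-- Membership in a shifted graded piece, witnessed by a homogeneous polynomial. -/
theorem mem_gradedPieceShifted {α β : SignVector I} {n : ℕ} {x : 𝒱.R (𝒱.Δ₂ α β)} :
    x ∈ gradedPieceShifted 𝒱 α β n ↔ ∃ k f, f.IsWeightedHomogeneous (fun _ : I => 2) k ∧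
      𝒱.mkR _ f = x ∧ (SignVector.dist α β + k = n ∨ f = 0) := by
  by_cases h : SignVector.dist α β ≤ n
  · rw [gradedPieceShifted, if_pos h]
    constructor
    · rintro ⟨f, hf, rfl⟩
      exact ⟨_, f, hf, rfl, Or.inl (Nat.add_sub_of_le h)⟩
    · rintro ⟨k, f, hf, rfl, hk | rfl⟩
      · obtain rfl : k = n - SignVector.dist α β := by omega
        exact ⟨f, hf, rfl⟩
      · rw [map_zero]
        exact Submodule.zero_mem _
  · rw [gradedPieceShifted, if_neg h, Submodule.mem_bot]
    constructor
    · rintro rfl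
      exact ⟨0, 0, MvPolynomial.isWeightedHomogeneous_zero _ _ _, map_zero _, Or.inr rfl⟩
    · rintro ⟨k, f, hf, rfl, hk | rfl⟩
      · omega
      · exact map_zero _

theorem single_mem_gradedPiece {a b : 𝒱.P} {n : ℕ} {x : 𝒱.R (𝒱.Δ₂ a b)}
    (hx : x ∈ gradedPieceShifted 𝒱 a b n) : single 𝒱 a b x ∈ gradedPiece 𝒱 n := by
  intro a' b'
  by_cases h : a' ≠ a ∨ b' ≠ b
  · rw [single_apply_ne _ h]
    exact Submodule.zero_mem _
  · push Not at h
    obtain ⟨rfl, rfl⟩ := h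
    rwa [single_apply_self]

theorem ζ_mem_gradedPiece {f : MvPolynomial I ℝ} {n : ℕ}
    (hf : f.IsWeightedHomogeneous (fun _ : I => 2) n) : ζ 𝒱 f ∈ gradedPiece 𝒱 n := by
  intro a b
  by_cases h : a = b
  · subst h
    rw [ζ_apply_self]
    exact mem_gradedPieceShifted.2 ⟨n, f, hf, rfl, Or.inl (by simp)⟩
  · rw [ζ_apply_ne _ h]
    exact Submodule.zero_mem _

theorem one_mem_gradedPiece : (1 : 𝒱.B) ∈ gradedPiece 𝒱 0 :=
  ζ_mem_gradedPiece (MvPolynomial.isWeightedHomogeneous_one _ _)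

theorem unitOrZero_mem_gradedPiece (α β : SignVector I) :
    unitOrZero 𝒱 α β ∈ gradedPiece 𝒱 (SignVector.dist α β) := by
  by_cases h : α ∈ 𝒱.P ∧ β ∈ 𝒱.P
  · rw [unitOrZero_of_mem h.1 h.2]
    exact single_mem_gradedPiece (mem_gradedPieceShifted.2
      ⟨0, 1, MvPolynomial.isWeightedHomogeneous_one _ _, map_one _, Or.inl rfl⟩)
  · rw [unitOrZero, dif_neg h]
    exact Submodule.zero_mem _

theorem mul_mem_gradedPiece (m n : ℕ) (x y : 𝒱.B) (hx : x ∈ gradedPiece 𝒱 m)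
    (hy : y ∈ gradedPiece 𝒱 n) : x * y ∈ gradedPiece 𝒱 (m + n) := by
  intro a c
  rw [mul_apply]
  refine Submodule.sum_mem _ fun b _ => ?_
  obtain ⟨k, f, hf, hfx, hk⟩ := mem_gradedPieceShifted.1 (hx a b)
  obtain ⟨l, g, hg, hgy, hl⟩ := mem_gradedPieceShifted.1 (hy b c)
  rw [← hfx, ← hgy, star_mk]
  refine mem_gradedPieceShifted.2
    ⟨_, _, (isWeightedHomogeneous_u (SignVector.S a.1 b.1 c.1)).mul (hf.mul hg), rfl, ?_⟩
  have hd := SignVector.dist_add_dist a.1 b.1 c.1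
  rcases hk with hk | rfl
  · rcases hl with hl | rfl
    · left
      omega
    · right
      rw [mul_zero, mul_zero]
  · right
    rw [zero_mul, mul_zero]

variable (𝒱) in
/-- The projection of `B` to its degree `n` part. -/
def proj (n : ℕ) : 𝒱.B →ₗ[ℝ] 𝒱.B where
  toFun x a b := if SignVector.dist a.1 b.1 ≤ n then
    projR 𝒱 _ (n - SignVector.dist a.1 b.1) (x a b) else 0
  map_add' x y := by
    funext a b
    change (if _ then projR 𝒱 _ _ (x a b + y a b) else 0) =
      (if _ then _ else _) + (if _ then _ else _)
    by_cases h : SignVector.dist a.1 b.1 ≤ n <;> simp [h]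
  map_smul' r x := by
    funext a b
    change (if _ then projR 𝒱 _ _ (r • x a b) else 0) = r • (if _ then _ else _)
    by_cases h : SignVector.dist a.1 b.1 ≤ n <;> simp [h]

theorem proj_apply (n : ℕ) (x : 𝒱.B) (a b : 𝒱.P) : proj 𝒱 n x a b =
    if SignVector.dist a.1 b.1 ≤ n then
      projR 𝒱 _ (n - SignVector.dist a.1 b.1) (x a b) else 0 := rfl

theorem proj_same {n : ℕ} {x : 𝒱.B} (hx : x ∈ gradedPiece 𝒱 n) : proj 𝒱 n x = x := by
  funext a b
  have h1 := hx a b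
  rw [proj_apply]
  by_cases h : SignVector.dist a.1 b.1 ≤ n
  · rw [gradedPieceShifted, if_pos h] at h1
    rw [if_pos h, projR_same 𝒱 _ h1]
  · rw [gradedPieceShifted, if_neg h, Submodule.mem_bot] at h1
    rw [if_neg h, h1]

theorem proj_ne {m n : ℕ} (hmn : n ≠ m) {x : 𝒱.B} (hx : x ∈ gradedPiece 𝒱 m) :
    proj 𝒱 n x = 0 := by
  funext a b
  have h1 := hx a b
  rw [proj_apply]
  change _ = (0 : 𝒱.R _)
  by_cases h : SignVector.dist a.1 b.1 ≤ n
  · rw [if_pos h]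
    by_cases h' : SignVector.dist a.1 b.1 ≤ m
    · rw [gradedPieceShifted, if_pos h'] at h1
      exact projR_ne 𝒱 _ (by omega) h1
    · rw [gradedPieceShifted, if_neg h', Submodule.mem_bot] at h1
      rw [h1, map_zero]
  · rw [if_neg h]

variable (𝒱) in
theorem iSup_gradedPiece : ⨆ n, gradedPiece 𝒱 n = ⊤ := by
  refine Submodule.eq_top_iff'.2 fun x => ?_
  rw [← sum_single x]
  refine Submodule.sum_mem _ fun a _ => Submodule.sum_mem _ fun b _ => ?_
  obtain ⟨f, hf⟩ := 𝒱.mkR_surjective _ (x a b)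
  rw [← hf]
  clear hf
  induction f using MvPolynomial.induction_on' with
  | monomial s r =>
    exact Submodule.mem_iSup_of_mem _ (single_mem_gradedPiece (mem_gradedPieceShifted.2
      ⟨_, _, MvPolynomial.isWeightedHomogeneous_monomial _ s r rfl, rfl, Or.inl rfl⟩))
  | add f g hf hg =>
    have hadd : single 𝒱 a b (𝒱.mkR _ (f + g)) =
        single 𝒱 a b (𝒱.mkR _ f) + single 𝒱 a b (𝒱.mkR _ g) := by
      funext a' b'
      rw [add_apply]
      by_cases h : a' ≠ a ∨ b' ≠ b
      · rw [single_apply_ne _ h, single_apply_ne _ h, single_apply_ne _ h, add_zero]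
      · push Not at h
        obtain ⟨rfl, rfl⟩ := h
        rw [single_apply_self, single_apply_self, single_apply_self, map_add]
    rw [hadd]
    exact add_mem hf hg

variable (𝒱) in
theorem nonempty_gradedAlgebra : Nonempty (GradedAlgebra (gradedPiece 𝒱)) :=
  nonempty_gradedAlgebra_of_proj _ one_mem_gradedPiece mul_mem_gradedPiece (proj 𝒱)
    (fun _ _ hx => proj_same hx) (fun _ _ h _ hx => proj_ne h hx) (iSup_gradedPiece 𝒱)

end B

namespace A

variable (𝒲 : PolarizedArrangement I)

theorem polyToSym_monomial_mem (s : I →₀ ℕ) :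
    polyToSym 𝒲 (MvPolynomial.monomial s 1) ∈
      LinearMap.range (SymmetricAlgebra.ι ℝ (Module.Dual ℝ 𝒲.V)) ^ s.degree := by
  induction s using Finsupp.induction_linear with
  | zero =>
    rw [map_zero, pow_zero]
    exact Submodule.mem_one.2 ⟨1, by rw [map_one]; exact (map_one _).symm⟩
  | add s t hs ht =>
    have h : (MvPolynomial.monomial (s + t) 1 : MvPolynomial I ℝ) =
        MvPolynomial.monomial s 1 * MvPolynomial.monomial t 1 := by
      rw [MvPolynomial.monomial_mul, one_mul]
    rw [h, map_mul, map_add, pow_add]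
    exact Submodule.mul_mem_mul hs ht
  | single i n =>
    rw [Finsupp.degree_single, ← MvPolynomial.X_pow_eq_monomial, map_pow, polyToSym,
      MvPolynomial.aeval_X]
    exact Submodule.pow_mem_pow _ (LinearMap.mem_range_self _ _) n

/-- A homogeneous polynomial of degree `k` times a taut path from `a` to `c` has degree
`d_{ac} + k`. -/
theorem polyHom_mul_taut_mem_gradedPiece (a c : 𝒲.Vertex) {k : ℕ} {f : MvPolynomial I ℝ}
    (hf : f.IsWeightedHomogeneous (fun _ : I => 2) k) :
    polyHom 𝒲 f * taut 𝒲 a c ∈ gradedPiece 𝒲 (SignVector.dist a.1 c.1 + k) := by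
  induction hf using MvPolynomial.IsWeightedHomogeneous.induction_on with
  | zero => simp
  | add p q _ _ hp hq =>
    rw [map_add, add_mul]
    exact add_mem hp hq
  | monomial s r hs =>
    have h : (MvPolynomial.monomial s r : MvPolynomial I ℝ) =
        r • MvPolynomial.monomial s 1 := by
      rw [MvPolynomial.smul_monomial, smul_eq_mul, mul_one]
    rw [h, map_smul, smul_mul_assoc]
    refine Submodule.smul_mem _ _ (Submodule.subset_span ?_)
    obtain ⟨x, hx, hxt⟩ := exists_taut_eq_mk 𝒲 a c
    refine ⟨_, s.degree, ?_, x, hx, _, polyToSym_monomial_mem 𝒲 s, ?_⟩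
    · rw [← hs, Finsupp.weight_eq_sum, Finsupp.degree_eq_sum, Finset.mul_sum]
      simp [mul_comm]
    · rw [hxt, polyHom_apply, ← map_mul, Algebra.TensorProduct.tmul_mul_tmul, one_mul, mul_one]

/-- The algebra `A` is generated by the `e_α`, the `p(α, β)` and the `t_i`. -/
theorem algHom_ext {C : Type*} [Ring C] [Algebra ℝ C] {f g : 𝒲.A →ₐ[ℝ] C}
    (he : ∀ a, f (e 𝒲 a) = g (e 𝒲 a))
    (hp : ∀ (a b : 𝒲.Vertex) (h : SignVector.Adj a.1 b.1), f (p 𝒲 h) = g (p 𝒲 h))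
    (ht : ∀ i, f (t 𝒲 i) = g (t 𝒲 i)) : f = g := by
  have hpoly : f.comp (polyHom 𝒲) = g.comp (polyHom 𝒲) := by
    ext i
    simpa using ht i
  have htaut : ∀ a b, f (taut 𝒲 a b) = g (taut 𝒲 a b) := by
    intro a b
    have h := isTaut_taut 𝒲 a b
    generalize taut 𝒲 a b = x at h
    induction h with
    | nil a => exact he a
    | cons i hi h hic hx ih => rw [map_mul, map_mul, hp, ih]
  have htop := eq_top_of_polyHom_mul_taut_mem (LinearMap.eqLocus f.toLinearMap g.toLinearMap)
    fun q a b => by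
      change f (polyHom 𝒲 q * taut 𝒲 a b) = g (polyHom 𝒲 q * taut 𝒲 a b)
      rw [map_mul, map_mul, htaut]
      exact congrArg (· * _) (DFunLike.congr_fun hpoly q)
  refine AlgHom.ext fun x => ?_
  have hx : x ∈ LinearMap.eqLocus f.toLinearMap g.toLinearMap := htop ▸ Submodule.mem_top
  exact hx

end A

namespace GaleDuality

variable (𝒱 : PolarizedArrangement I)

theorem pathMap_mem_gradedPiece {a b : 𝒱.galeDual.Vertex} (q : Quiver.Path a b) :
    pathMap 𝒱 q ∈ B.gradedPiece 𝒱 q.length := by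
  induction q with
  | nil =>
    have h := B.unitOrZero_mem_gradedPiece (𝒱 := 𝒱) a.1 a.1
    rwa [SignVector.dist_self] at h
  | @cons b c q f ih =>
    have h := B.unitOrZero_mem_gradedPiece (𝒱 := 𝒱) b.1 c.1
    rw [SignVector.dist_of_adj f.down] at h
    exact B.mul_mem_gradedPiece _ _ _ _ ih h

theorem symHom_mem_gradedPiece {m : ℕ} {s : SymmetricAlgebra ℝ (Module.Dual ℝ 𝒱.galeDual.V)}
    (hs : s ∈ LinearMap.range (SymmetricAlgebra.ι ℝ (Module.Dual ℝ 𝒱.galeDual.V)) ^ m) :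
    symHom 𝒱 s ∈ B.gradedPiece 𝒱 (2 * m) := by
  induction m generalizing s with
  | zero =>
    rw [pow_zero] at hs
    obtain ⟨r, rfl⟩ := Submodule.mem_one.1 hs
    rw [AlgHom.commutes, Algebra.algebraMap_eq_smul_one]
    exact Submodule.smul_mem _ _ B.one_mem_gradedPiece
  | succ m ih =>
    rw [pow_succ] at hs
    induction hs using Submodule.mul_induction_on' with
    | mem_mul_mem x hx y hy =>
      obtain ⟨g, rfl⟩ := hy
      obtain ⟨v, rfl⟩ := dotRestrict_surjective 𝒱.galeDual.V g
      rw [map_mul]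
      refine B.mul_mem_gradedPiece (2 * m) 2 _ _ (ih hx) ?_
      rw [← A.sum_smul_coord, map_sum, map_sum]
      refine Submodule.sum_mem _ fun i _ => ?_
      have h1 : SymmetricAlgebra.ι ℝ _ (𝒱.galeDual.coord i) =
          A.polyToSym 𝒱.galeDual (MvPolynomial.X i) := by
        rw [A.polyToSym, MvPolynomial.aeval_X]
      rw [map_smul, map_smul, h1, symHom_polyToSym]
      exact Submodule.smul_mem _ _
        (B.ζ_mem_gradedPiece (MvPolynomial.isWeightedHomogeneous_X ℝ _ i))
    | add x _ y _ hx hy =>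
      rw [map_add]
      exact add_mem hx hy

/-- The homomorphism `φ` identifies the graded pieces. -/
theorem map_gradedPiece (n : ℕ) :
    (A.gradedPiece 𝒱.galeDual n).map (equiv 𝒱).toLinearMap = B.gradedPiece 𝒱 n := by
  refine le_antisymm (Submodule.map_le_iff_le_comap.2 (Submodule.span_le.2 ?_)) fun x hx => ?_
  · rintro _ ⟨l, m, rfl, x, hx, s, hs, rfl⟩
    change hom 𝒱 (A.mk 𝒱.galeDual (x ⊗ₜ s)) ∈ B.gradedPiece 𝒱 (l + 2 * m)
    rw [hom_mk, preHom_tmul]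
    refine B.mul_mem_gradedPiece _ _ _ _ ?_ (symHom_mem_gradedPiece 𝒱 hs)
    refine PathAlgebra.induction_on_gradedPiece
      (motive := fun x => pathHom 𝒱 x ∈ B.gradedPiece 𝒱 l) hx ?_ (fun x y hx hy => ?_)
      (fun r x hx => ?_) fun a b q hq => ?_
    · rw [map_zero]; exact Submodule.zero_mem _
    · rw [map_add]; exact add_mem hx hy
    · rw [map_smul]; exact Submodule.smul_mem _ _ hx
    · rw [pathHom_ofPath, ← hq]
      exact pathMap_mem_gradedPiece 𝒱 q
  · refine ⟨inv 𝒱 x, ?_, hom_inv 𝒱 x⟩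
    change ∑ a, ∑ b, invComponent 𝒱 a b (x a b) ∈ _
    refine Submodule.sum_mem _ fun a _ => Submodule.sum_mem _ fun b _ => ?_
    obtain ⟨k, f, hf, hfx, hk⟩ := B.mem_gradedPieceShifted.1 (hx a b)
    rw [← hfx, invComponent_mkR]
    rcases hk with rfl | rfl
    · exact A.polyHom_mul_taut_mem_gradedPiece 𝒱.galeDual (vertex 𝒱 a) (vertex 𝒱 b) hf
    · rw [map_zero, zero_mul]
      exact Submodule.zero_mem _

theorem mem_gradedPiece_iff (n : ℕ) (x : 𝒱.galeDual.A) :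
    x ∈ A.gradedPiece 𝒱.galeDual n ↔ equiv 𝒱 x ∈ B.gradedPiece 𝒱 n := by
  rw [← map_gradedPiece]
  constructor
  · exact fun hx => ⟨x, hx, rfl⟩
  · rintro ⟨y, hy, hyx⟩
    rwa [← (equiv 𝒱).injective hyx]

/-- The projection of `A(𝒱^∨)` to its degree `n` part. -/
def projA (n : ℕ) : 𝒱.galeDual.A →ₗ[ℝ] 𝒱.galeDual.A :=
  (equiv 𝒱).symm.toLinearMap ∘ₗ B.proj 𝒱 n ∘ₗ (equiv 𝒱).toLinearMap

theorem nonempty_gradedAlgebra : Nonempty (GradedAlgebra (A.gradedPiece 𝒱.galeDual)) := by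
  refine nonempty_gradedAlgebra_of_proj (A := 𝒱.galeDual.A) (A.gradedPiece 𝒱.galeDual) ?_
    (fun m n x y hx hy => ?_) (projA 𝒱)
    (fun n x hx => ?_) (fun m n h x hx => ?_) ?_
  · rw [mem_gradedPiece_iff, map_one]
    exact B.one_mem_gradedPiece
  · rw [mem_gradedPiece_iff] at hx hy ⊢
    rw [map_mul]
    exact B.mul_mem_gradedPiece m n _ _ hx hy
  · rw [mem_gradedPiece_iff] at hx
    change (equiv 𝒱).symm (B.proj 𝒱 n (equiv 𝒱 x)) = x
    rw [B.proj_same hx, AlgEquiv.symm_apply_apply]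
  · rw [mem_gradedPiece_iff] at hx
    change (equiv 𝒱).symm (B.proj 𝒱 n (equiv 𝒱 x)) = 0
    rw [B.proj_ne h hx, map_zero]
  · refine Submodule.map_injective_of_injective (f := (equiv 𝒱).toLinearMap)
      (equiv 𝒱).injective ?_
    simp only [Submodule.map_iSup, map_gradedPiece, B.iSup_gradedPiece]
    rw [Submodule.map_top, eq_comm, LinearMap.range_eq_top]
    exact (equiv 𝒱).surjective

end GaleDuality

end PolarizedArrangement

end

theorem theorem4 {I : Type*} [Fintype I] (𝒱 : PolarizedArrangement I) :
    𝒱.galeDual.P = 𝒱.P ∧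
    Nonempty (GradedAlgebra (PolarizedArrangement.A.gradedPiece 𝒱.galeDual)) ∧
    Nonempty (GradedAlgebra (PolarizedArrangement.B.gradedPiece 𝒱)) ∧
    ∃! φ : 𝒱.galeDual.A ≃ₐ[ℝ] 𝒱.B,
      (∀ n : ℕ, (PolarizedArrangement.A.gradedPiece 𝒱.galeDual n).map φ.toLinearMap =
        PolarizedArrangement.B.gradedPiece 𝒱 n) ∧
      (∀ (a : 𝒱.galeDual.Vertex) (ha : a.1 ∈ 𝒱.P),
        φ (PolarizedArrangement.A.e 𝒱.galeDual a) =
          PolarizedArrangement.B.unit 𝒱 ⟨a.1, ha⟩ ⟨a.1, ha⟩) ∧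
      (∀ (a b : 𝒱.galeDual.Vertex) (ha : a.1 ∈ 𝒱.P) (hb : b.1 ∈ 𝒱.P)
        (hab : SignVector.Adj a.1 b.1),
        φ (PolarizedArrangement.A.p 𝒱.galeDual hab) =
          PolarizedArrangement.B.unit 𝒱 ⟨a.1, ha⟩ ⟨b.1, hb⟩) ∧
      (∀ i : I, φ (PolarizedArrangement.A.t 𝒱.galeDual i) =
        PolarizedArrangement.B.ζ 𝒱 (MvPolynomial.X i)) := by
  open PolarizedArrangement in
  refine ⟨𝒱.galeDual_P, GaleDuality.nonempty_gradedAlgebra 𝒱, B.nonempty_gradedAlgebra 𝒱,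
    GaleDuality.equiv 𝒱, ⟨GaleDuality.map_gradedPiece 𝒱,
      fun a ha => (GaleDuality.hom_e 𝒱 a).trans (B.unitOrZero_of_mem ha ha),
      fun a b ha hb hab => (GaleDuality.hom_p 𝒱 hab).trans (B.unitOrZero_of_mem ha hb),
      GaleDuality.hom_t 𝒱⟩, ?_⟩
  rintro φ ⟨-, he, hp, ht⟩
  have he0 : ∀ a : 𝒱.galeDual.Vertex, a.1 ∉ 𝒱.P → A.e 𝒱.galeDual a = 0 := fun a ha =>
    A.e_eq_zero _ (by rwa [galeDual_P])
  have h : (φ : 𝒱.galeDual.A →ₐ[ℝ] 𝒱.B) = GaleDuality.hom 𝒱 := by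
    refine A.algHom_ext 𝒱.galeDual (fun a => ?_) (fun a b hab => ?_) fun i => ?_
    · by_cases ha : a.1 ∈ 𝒱.P
      · exact (he a ha).trans ((GaleDuality.hom_e 𝒱 a).trans (B.unitOrZero_of_mem ha ha)).symm
      · rw [he0 a ha, map_zero, map_zero]
    · by_cases ha : a.1 ∈ 𝒱.P
      · by_cases hb : b.1 ∈ 𝒱.P
        · exact (hp a b ha hb hab).trans
            ((GaleDuality.hom_p 𝒱 hab).trans (B.unitOrZero_of_mem ha hb)).symm
        · rw [← A.p_mul_e, he0 b hb, mul_zero, map_zero, map_zero]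
      · rw [← A.e_mul_p, he0 a ha, zero_mul, map_zero, map_zero]
    · exact (ht i).trans (GaleDuality.hom_t 𝒱 i).symm
  exact AlgEquiv.ext fun x => DFunLike.congr_fun h x
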